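/- Let $p$ be a prime and $n\ge 1$. An $n$-tangle diagram is a generic diagram, in a disk, of finitely many strings and closed curves with over/under information at each crossing, whose $2n$ string ends are $2n$ points on the boundary circle, numbered $1,\dots,2n$ in cyclic order; closed components (also ones without crossings) are allowed. A Fox $p$-coloring of such a diagram $T$ assigns an element of $\mathbb{Z}_p=\mathbb{Z}/p\mathbb{Z}$ to each arc of $T$ (arcs are the pieces of the curves between consecutive undercrossings or ends, and closed curves without an undercrossing) so that at each crossing the sum of the colors of the two undercrossing arcs equals twice the color of the overcrossing arc. The Fox $p$-colorings form a $\mathbb{Z}_p$-vector space $\mathrm{Col}_p(T)$, and restricting a coloring to the boundary points gives a linear map $\psi_T:\mathrm{Col}_p(T)\to\mathbb{Z}_p^{2n}$. Let $$\mathbb{Z}_p^{2n-1}=\Bigl\{(a_1,\dots,a_{2n})\in\mathbb{Z}_p^{2n} : \sum_{i=1}^{2n}(-1)^i a_i=0\Bigr\}$$ be the subspace of vectors that satisfy the alternating condition. Then every $p$-coloring $\mathbf{x}\in\mathbb{Z}_p^{2n-1}$ of the boundary points is induced by some Fox $p$-coloring of some $n$-tangle diagram $T$, and every coloring of the boundary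 points induced by a Fox $p$-coloring satisfies the alternating condition, i.e. $$\mathbb{Z}_p^{2n-1}=\bigcup_T\psi_T(\mathrm{Col}_p T),$$ where $T$ runs over all $n$-tangle diagrams. Moreover, $\psi_T(\mathrm{Col}_pT)$ has dimension $n$ over $\mathbb{Z}_p$ for every $n$-tangle diagram $T$. -/

import Mathlib

/-- The number of orbits on `D` of the group generated by a set `S` of permutations of `D`. -/
noncomputable def numOrbits {D : Type} (S : Set (Equiv.Perm D)) : ℕ :=
  Nat.card (MulAction.orbitRel.Quotient (Subgroup.closure S) D)

/-- A combinatorial map on a finite set `D` of half-edges consists of a permutation `rot`, which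
sends a half-edge to the next one in counterclockwise order around its vertex, and a fixed point
free involution `edge`, which interchanges the two halves of each edge. Its vertices, edges, faces
and connected components are the orbits of `rot`, of `edge`, of `rot * edge` and of the group
generated by `rot` and `edge`. It describes a graph drawn on the sphere exactly if every component
has genus zero, that is, if Euler's formula `V + F = E + 2 C` holds. -/
def IsPlanarMap {D : Type} (rot edge : Equiv.Perm D) : Prop :=
  numOrbits {rot} + numOrbits {rot * edge} = numOrbits {edge} + 2 * numOrbits {rot, edge}

/-- The half-edges of a diagram in a disk with set of crossings `X` and `2 * n` boundary points:
four of them at each crossing, and one ending at each point on the boundary of the disk.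
The half-edges `(c, 0), (c, 1), (c, 2), (c, 3)` at a crossing `c` are listed in counterclockwise
order; `(c, 0)` and `(c, 2)` form the undercrossing strand, `(c, 1)` and `(c, 3)` the overcrossing
strand. The boundary points `0, 1, …, 2 * n - 1` are listed in counterclockwise order along the
boundary circle. -/
abbrev HalfEdge (n : ℕ) (X : Type) : Type := (X × Fin 4) ⊕ Fin (2 * n)

/-- The rotation around the vertices, when the complement of the disk in the sphere is shrunk to
one further vertex. Around that vertex the boundary points, which are listed counterclockwise as
seen from the disk, follow each other counterclockwise in decreasing order. -/
def diskRotation (n : ℕ) (X : Type) : Equiv.Perm (HalfEdge n X) :=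
  Equiv.sumCongr (Equiv.prodCongr (Equiv.refl X) (finRotate 4)) (finRotate (2 * n)).symm

/-- A diagram of an `n`-tangle: a finite graph drawn in the disk without crossing edges, with
four-valent vertices (the crossings, each with a choice of the over- and the undercrossing strand)
and `2 * n` univalent vertices (the boundary points) on the boundary circle, together with
`loops` further closed components that take part in no crossing. -/
structure TangleDiagram (n : ℕ) where
  /-- The crossings. -/
  Crossing : Type
  /-- There are finitely many crossings. -/
  finite_crossing : Finite Crossing
  /-- The other half of the edge to which a half-edge belongs. -/
  edge : Equiv.Perm (HalfEdge n Crossing)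
  edge_edge : ∀ d, edge (edge d) = d
  edge_ne : ∀ d, edge d ≠ d
  /-- The diagram is drawn in the disk. -/
  planar : IsPlanarMap (diskRotation n Crossing) edge
  /-- The number of closed components without crossings. -/
  loops : ℕ

namespace TangleDiagram

variable {n : ℕ} (T : TangleDiagram n)

/-- One step along an arc of the diagram: along an edge, or through a crossing as overstrand. -/
inductive ArcStep : HalfEdge n T.Crossing → HalfEdge n T.Crossing → Prop
  | along (d : HalfEdge n T.Crossing) : ArcStep d (T.edge d)
  | over (c : T.Crossing) : ArcStep (Sum.inl (c, 1)) (Sum.inl (c, 3))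

/-- The arcs of the diagram. Apart from the closed components without crossings they are
the maximal pieces of the strands that pass through no undercrossing: they run from an
undercrossing or boundary point to an undercrossing or boundary point, or are closed. -/
def Arc : Type := Quot T.ArcStep ⊕ Fin T.loops

/-- The arc to which a half-edge belongs. -/
def arc (d : HalfEdge n T.Crossing) : T.Arc := Sum.inl (Quot.mk T.ArcStep d)

/-- The module of Fox `k`-colorings of the diagram: colorings of the arcs by `ℤ / k` such that at
each crossing the sum of the colors of the undercrossings is twice the color of the
overcrossing. -/
def Col (k : ℕ) : Submodule (ZMod k) (T.Arc → ZMod k) where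
  carrier := {x | ∀ c : T.Crossing,
    x (T.arc (Sum.inl (c, 0))) + x (T.arc (Sum.inl (c, 2))) = 2 * x (T.arc (Sum.inl (c, 1)))}
  add_mem' := by
    intro x y hx hy c
    simp only [Pi.add_apply]
    linear_combination hx c + hy c
  zero_mem' := by
    intro c
    simp
  smul_mem' := by
    intro a x hx c
    simp only [Pi.smul_apply, smul_eq_mul]
    linear_combination a * hx c

/-- The coloring of the boundary points induced by a Fox coloring of the diagram. -/
def psi (k : ℕ) : T.Col k →ₗ[ZMod k] (Fin (2 * n) → ZMod k) where
  toFun x := fun i => x.1 (T.arc (Sum.inr i))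
  map_add' _ _ := rfl
  map_smul' _ _ := rfl

end TangleDiagram

/-- The colorings `a` of `2 * n` points that satisfy the alternating condition
`- a₁ + a₂ - ⋯ + a₂ₙ = 0`; here the points are numbered from zero. -/
def alternatingColorings (k n : ℕ) : Submodule (ZMod k) (Fin (2 * n) → ZMod k) where
  carrier := {a | ∑ i : Fin (2 * n), (-1) ^ ((i : ℕ) + 1) * a i = 0}
  add_mem' := by
    intro a b ha hb
    simp only [Set.mem_ofPred_eq, Pi.add_apply, mul_add, Finset.sum_add_distrib] at *
    rw [ha, hb, add_zero]
  zero_mem' := by simp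
  smul_mem' := by
    intro r a ha
    simp only [Set.mem_ofPred_eq, Pi.smul_apply, smul_eq_mul] at *
    simp only [mul_left_comm _ r, ← Finset.mul_sum, ha, mul_zero]

open Module

/-! A diagram is treated as a planar map on the sphere, the outside of the disk being shrunk to one
vertex. Orbit counts are dimensions of spaces of invariant functions, and Euler's formula says that
every circulation is the difference of a function on the faces (`isPlanarMap_iff`).

Alternating condition: all vertices have even degree, so the faces have a checkerboard sign `s`
(`exists_checkerboard`). For a Fox coloring `x`, the function `s * x` changes sign along edges and
has sum zero at each crossing, so its sum over the boundary points is zero as well, and there `s`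
alternates.

Dimension: `s * x` is thus a circulation, and comes from a function on the faces, a potential. Only
constants are lost in passing from boundary values of potentials to boundary colorings, so these
values must form a space of dimension `n + 1`. The skew form `∑ u i * (v (i - 1) - v (i + 1))` on
the boundary circle has a radical of dimension at most 2 and vanishes on that space, which gives `≤`
(`finrank_boundaryPotentials_le`). For `≥`, crossing equations are counted against faces; potentials
that vanish on the boundary supply enough dependencies among these equations
(`le_finrank_boundaryPotentials`).

Existence: crossing the strands at neighbouring ends `i`, `i + 1` adds a multiple of `a (i + 1) - a
i` to both colors and keeps their difference. As `p` is prime, a nonzero difference lets repeated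
crossings add any constant to both. At most two such twists make the last two colors equal; these
ends are then joined by a strand, and induction on `n` finishes. -/

theorem Submodule.finrank_map_add_finrank_inf_ker {K V V' : Type*} [Field K] [AddCommGroup V]
    [Module K V] [FiniteDimensional K V] [AddCommGroup V'] [Module K V'] (f : V →ₗ[K] V')
    (W : Submodule K V) :
    finrank K (W.map f) + finrank K (W ⊓ LinearMap.ker f : Submodule K V) = finrank K W := by
  have h := LinearMap.finrank_range_add_finrank_ker (f.domRestrict W)
  have hf := Submodule.finrank_map_subtype_eq W (LinearMap.ker (f.domRestrict W))
  have hk : (LinearMap.ker (f.domRestrict W)).map W.subtype = W ⊓ LinearMap.ker f := by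
    ext v
    simp [LinearMap.mem_ker, and_comm]
  rw [hk] at hf
  rwa [LinearMap.range_domRestrict, ← hf] at h

/-! ### Orbit counts as dimensions, and orthogonal complements -/

section LinearAlgebra

variable {D : Type} (K : Type) [Field K]

/-- The functions that are constant on the orbits of a set `S` of permutations. -/
def invariantFunctions (S : Set (Equiv.Perm D)) : Submodule K (D → K) where
  carrier := {f | ∀ σ ∈ S, ∀ d, f (σ d) = f d}
  add_mem' hf hg σ hσ d := by simp [hf σ hσ d, hg σ hσ d]
  zero_mem' _ _ _ := rfl
  smul_mem' a f hf σ hσ d := by simp [hf σ hσ d]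

variable {K}

theorem mem_invariantFunctions {S : Set (Equiv.Perm D)} {f : D → K} :
    f ∈ invariantFunctions K S ↔ ∀ σ ∈ S, ∀ d, f (σ d) = f d := Iff.rfl

theorem mem_invariantFunctions_singleton {σ : Equiv.Perm D} {f : D → K} :
    f ∈ invariantFunctions K {σ} ↔ ∀ d, f (σ d) = f d := by
  simp [mem_invariantFunctions]

theorem mem_invariantFunctions_pair {σ τ : Equiv.Perm D} {f : D → K} :
    f ∈ invariantFunctions K {σ, τ} ↔ (∀ d, f (σ d) = f d) ∧ ∀ d, f (τ d) = f d := by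
  simp [mem_invariantFunctions]

/-- Invariant functions are the pullbacks of functions on the set of orbits. -/
theorem finrank_invariantFunctions [Finite D] (S : Set (Equiv.Perm D)) :
    finrank K (invariantFunctions K S) = numOrbits S := by
  let Q := MulAction.orbitRel.Quotient (Subgroup.closure S) D
  let π : D → Q := Quotient.mk _
  have hπ : Function.Surjective π := Quotient.mk_surjective
  have : Fintype Q := Fintype.ofFinite Q
  have hr : LinearMap.range (LinearMap.funLeft K K π) = invariantFunctions K S := by
    ext f
    constructor
    · rintro ⟨g, rfl⟩ σ hσ d
      have : π (σ d) = π d :=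
        Quotient.sound ⟨⟨σ, Subgroup.subset_closure hσ⟩, rfl⟩
      simp [LinearMap.funLeft_apply, this]
    · intro hf
      have key : ∀ τ ∈ Subgroup.closure S, ∀ d, f (τ d) = f d := by
        intro τ hτ
        induction hτ using Subgroup.closure_induction with
        | mem σ hσ => exact hf σ hσ
        | one => intro d; rfl
        | mul σ τ _ _ hσ hτ => intro d; rw [Equiv.Perm.mul_apply, hσ, hτ]
        | inv σ _ hσ => intro d; simpa using (hσ (σ⁻¹ d)).symm
      refine ⟨fun q => Quotient.liftOn q f ?_, rfl⟩
      rintro _ b ⟨τ, rfl⟩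
      exact key τ τ.2 b
  rw [← hr, LinearMap.finrank_range_of_inj (LinearMap.funLeft_injective_of_surjective K K π hπ),
    finrank_fintype_fun_eq_card, ← Nat.card_eq_fintype_card]
  rfl

variable [Fintype D]

/-- The orthogonal complement for the dot product. -/
def dotPerp (W : Submodule K (D → K)) : Submodule K (D → K) :=
  LinearMap.BilinForm.orthogonal (dotProductBilin K K) W

theorem mem_dotPerp {W : Submodule K (D → K)} {z : D → K} :
    z ∈ dotPerp W ↔ ∀ w ∈ W, ∑ d, w d * z d = 0 := Iff.rfl

theorem dotProductBilin_isRefl :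
    LinearMap.BilinForm.IsRefl (dotProductBilin K K : (D → K) →ₗ[K] (D → K) →ₗ[K] K) := by
  intro x y h
  simpa [dotProduct_comm] using h

theorem dotProductBilin_nondegenerate :
    LinearMap.BilinForm.Nondegenerate
      (dotProductBilin K K : (D → K) →ₗ[K] (D → K) →ₗ[K] K) := by
  classical
  refine (LinearMap.IsRefl.nondegenerate_iff_separatingLeft
    fun x y h => dotProductBilin_isRefl x y h).mpr fun x hx => ?_
  funext d
  simpa using hx (Pi.single d 1)

theorem finrank_dotPerp (W : Submodule K (D → K)) :
    finrank K W + finrank K (dotPerp W) = Fintype.card D := by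
  have h := LinearMap.BilinForm.finrank_orthogonal (dotProductBilin_nondegenerate (K := K)) W
  have := Submodule.finrank_le W
  rw [finrank_fintype_fun_eq_card] at *
  rw [dotPerp]
  omega

theorem dotPerp_dotPerp (W : Submodule K (D → K)) : dotPerp (dotPerp W) = W :=
  LinearMap.BilinForm.orthogonal_orthogonal dotProductBilin_nondegenerate
    dotProductBilin_isRefl W

theorem dotPerp_sup (V W : Submodule K (D → K)) : dotPerp (V ⊔ W) = dotPerp V ⊓ dotPerp W := by
  ext z
  simp only [Submodule.mem_inf, mem_dotPerp]
  constructor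
  · intro h
    exact ⟨fun w hw => h w (le_sup_left (a := V) hw), fun w hw => h w (le_sup_right (a := V) hw)⟩
  · rintro ⟨h₁, h₂⟩ w hw
    obtain ⟨a, ha, b, hb, rfl⟩ := Submodule.mem_sup.mp hw
    simp [add_mul, Finset.sum_add_distrib, h₁ a ha, h₂ b hb]

end LinearAlgebra

/-! ### Euler's formula as the vanishing of first homology -/

section PlanarMap

variable {D : Type} [Fintype D] {K : Type} [Field K] {rot edge : Equiv.Perm D}

theorem mem_dotPerp_invariantFunctions_involution (hee : ∀ d, edge (edge d) = d)
    (hne : ∀ d, edge d ≠ d) {z : D → K} :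
    z ∈ dotPerp (invariantFunctions K {edge}) ↔ ∀ d, z (edge d) = - z d := by
  classical
  constructor
  · intro h d
    have := mem_dotPerp.mp h (Pi.single d 1 + Pi.single (edge d) 1) (by
      rw [mem_invariantFunctions_singleton]
      intro b
      have h1 : edge b = d ↔ b = edge d := by
        rw [← edge.injective.eq_iff, hee]
      simp [Pi.single_apply, h1, add_comm])
    simp only [Pi.add_apply, add_mul, Finset.sum_add_distrib, Pi.single_apply, ite_mul, one_mul,
      zero_mul, Finset.sum_ite_eq', Finset.mem_univ, if_true] at this
    linear_combination this
  · intro h w hw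
    rw [mem_invariantFunctions_singleton] at hw
    refine Finset.sum_involution (fun d _ => edge d) ?_ (fun d _ _ => hne d)
      (fun _ _ => Finset.mem_univ _) (fun d _ => hee d)
    intro d _
    rw [h, hw]
    ring

/-- Modulo 2 the edge-invariant functions are their own orthogonal complement, so they have half the
full dimension. -/
theorem two_mul_numOrbits_involution (hee : ∀ d, edge (edge d) = d) (hne : ∀ d, edge d ≠ d) :
    2 * numOrbits {edge} = Fintype.card D := by
  have h : dotPerp (invariantFunctions (ZMod 2) {edge}) = invariantFunctions (ZMod 2) {edge} := by
    ext z
    rw [mem_dotPerp_invariantFunctions_involution hee hne, mem_invariantFunctions_singleton]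
    simp only [ZModModule.neg_eq_self]
  have := finrank_dotPerp (invariantFunctions (ZMod 2) {edge})
  rw [h, finrank_invariantFunctions] at this
  omega

omit [Fintype D] in
theorem mem_invariantFunctions_face (hee : ∀ d, edge (edge d) = d) {u : D → K} :
    u ∈ invariantFunctions K {rot * edge} ↔ ∀ d, u (rot d) = u (edge d) := by
  rw [mem_invariantFunctions_singleton]
  constructor
  · intro h d
    simpa [hee] using h (edge d)
  · intro h d
    rw [Equiv.Perm.mul_apply, h, hee]

variable (K rot edge) in
/-- The circulations: functions on the half-edges that change sign along edges and have sum zero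
around every vertex. -/
def circulations : Submodule K (D → K) :=
  dotPerp (invariantFunctions K {edge}) ⊓ dotPerp (invariantFunctions K {rot})

variable (K rot edge) in
/-- The circulations that are differences of a function on the faces. -/
def faceBoundaries : Submodule K (D → K) :=
  (invariantFunctions K {rot * edge}).map (LinearMap.id - LinearMap.funLeft K K edge)

theorem faceBoundaries_le_circulations (hee : ∀ d, edge (edge d) = d) (hne : ∀ d, edge d ≠ d) :
    faceBoundaries K rot edge ≤ circulations K rot edge := by
  rintro _ ⟨u, hu, rfl⟩
  rw [SetLike.mem_coe, mem_invariantFunctions_face hee] at hu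
  refine ⟨?_, ?_⟩
  · rw [SetLike.mem_coe, mem_dotPerp_invariantFunctions_involution hee hne]
    intro d
    simp [LinearMap.funLeft_apply, hee]
  · intro w hw
    rw [mem_invariantFunctions_singleton] at hw
    change ∑ d, w d * (u d - u (edge d)) = 0
    simp only [← hu, mul_sub, Finset.sum_sub_distrib]
    rw [sub_eq_zero, ← Equiv.sum_comp rot]
    simp [hw]

/-- The circulations are the complement of a sum of two spaces of dimensions `E` and `V` that meet
in dimension `C`; the full dimension is `2 * E`. -/
theorem finrank_circulations (hee : ∀ d, edge (edge d) = d) (hne : ∀ d, edge d ≠ d) :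
    finrank K (circulations K rot edge) + numOrbits {rot} =
      numOrbits {edge} + numOrbits {rot, edge} := by
  have h₁ := Submodule.finrank_sup_add_finrank_inf_eq (invariantFunctions K {edge})
    (invariantFunctions K {rot})
  have h₂ := finrank_dotPerp (invariantFunctions K {edge} ⊔ invariantFunctions K {rot})
  have h₃ : invariantFunctions K {edge} ⊓ invariantFunctions K {rot} =
      invariantFunctions K {rot, edge} := by
    ext f
    rw [Submodule.mem_inf, mem_invariantFunctions_pair, mem_invariantFunctions_singleton,
      mem_invariantFunctions_singleton, and_comm]
  have h₄ := two_mul_numOrbits_involution hee hne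
  rw [dotPerp_sup] at h₂
  rw [h₃] at h₁
  simp only [finrank_invariantFunctions] at h₁
  rw [circulations]
  omega

/-- A face function with zero difference across every edge is constant on components, so the kernel
has dimension `C`. -/
theorem finrank_faceBoundaries (hee : ∀ d, edge (edge d) = d) :
    finrank K (faceBoundaries K rot edge) + numOrbits {rot, edge} =
      numOrbits {rot * edge} := by
  set Φ := invariantFunctions K {rot * edge}
  set δ : (D → K) →ₗ[K] (D → K) := LinearMap.id - LinearMap.funLeft K K edge
  have h := Φ.finrank_map_add_finrank_inf_ker δ
  have hk : Φ ⊓ LinearMap.ker δ = invariantFunctions K {rot, edge} := by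
    ext u
    rw [mem_invariantFunctions_pair, Submodule.mem_inf, mem_invariantFunctions_face hee]
    constructor
    · rintro ⟨hu, hk⟩
      have h₁ : ∀ d, u (edge d) = u d := fun d => (sub_eq_zero.mp (congrFun hk d)).symm
      exact ⟨fun d => (hu d).trans (h₁ d), h₁⟩
    · rintro ⟨hr, he⟩
      refine ⟨fun d => (hr d).trans (he d).symm, ?_⟩
      funext d
      exact sub_eq_zero.mpr (he d).symm
  rw [hk] at h
  simp only [finrank_invariantFunctions, Φ] at h
  exact h

variable (K) in
-- The two spaces have dimensions `E - V + C` and `F - C`, and these agree exactly under Euler's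
-- formula. Any one field suffices for the criterion.
theorem isPlanarMap_iff (hee : ∀ d, edge (edge d) = d) (hne : ∀ d, edge d ≠ d) :
    IsPlanarMap rot edge ↔ circulations K rot edge ≤ faceBoundaries K rot edge := by
  have h₁ := finrank_circulations (K := K) (rot := rot) hee hne
  have h₂ := finrank_faceBoundaries (K := K) (rot := rot) hee
  rw [IsPlanarMap]
  constructor
  · intro h
    exact (Submodule.eq_of_le_of_finrank_eq (faceBoundaries_le_circulations hee hne)
      (by omega)).ge
  · intro h
    rw [h.antisymm (faceBoundaries_le_circulations hee hne)] at h₁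
    omega

theorem IsPlanarMap.exists_potential (h : IsPlanarMap rot edge) (hee : ∀ d, edge (edge d) = d)
    (hne : ∀ d, edge d ≠ d) {z : D → K} (hz : ∀ d, z (edge d) = - z d)
    (hr : ∀ f : D → K, (∀ d, f (rot d) = f d) → ∑ d, f d * z d = 0) :
    ∃ u : D → K, (∀ d, u (rot d) = u (edge d)) ∧ ∀ d, z d = u d - u (rot d) := by
  obtain ⟨u, hu, rfl⟩ := (isPlanarMap_iff K hee hne).mp h
    ⟨(mem_dotPerp_invariantFunctions_involution hee hne).mpr hz,
      fun f hf => hr f (mem_invariantFunctions_singleton.mp hf)⟩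
  have hu := (mem_invariantFunctions_face hee).mp hu
  exact ⟨u, hu, fun d => by simp [LinearMap.funLeft_apply, hu]⟩

variable (K) in
theorem isPlanarMap_of_exists_potential (hee : ∀ d, edge (edge d) = d) (hne : ∀ d, edge d ≠ d)
    (h : ∀ z : D → K, (∀ d, z (edge d) = - z d) →
      (∀ f : D → K, (∀ d, f (rot d) = f d) → ∑ d, f d * z d = 0) →
      ∃ u : D → K, (∀ d, z d = u d - u (edge d)) ∧ ∀ d, z d = u d - u (rot d)) :
    IsPlanarMap rot edge := by
  rw [isPlanarMap_iff K hee hne]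
  rintro z ⟨hz, hr⟩
  obtain ⟨u, hu, hu'⟩ := h z ((mem_dotPerp_invariantFunctions_involution hee hne).mp hz)
    (fun f hf => hr f (mem_invariantFunctions_singleton.mpr hf))
  refine ⟨u, (mem_invariantFunctions_face hee).mpr fun d => ?_, ?_⟩
  · exact sub_right_injective ((hu' d).symm.trans (hu d))
  · funext d
    exact (hu d).symm

end PlanarMap

/-! ### Vertex sums for the rotation of a diagram -/

section Rotation

theorem eq_of_finRotate_invariant {α : Type*} {m : ℕ} {g : Fin m → α}
    (h : ∀ i, g (finRotate m i) = g i) (i j : Fin m) : g i = g j := by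
  cases m with
  | zero => exact i.elim0
  | succ m =>
    have key : ∀ i, g i = g 0 := by
      intro i
      induction i using Fin.induction with
      | zero => rfl
      | succ i ih =>
        rw [← ih, ← h i.castSucc]
        congr 1
        ext
        simp
    rw [key i, key j]

/-- Evenness of `m` makes the sign rule survive the step from the last index back to 0. -/
theorem neg_one_pow_finRotate {R : Type*} [Ring R] {m : ℕ} (hm : Even m) (i : Fin m) :
    (-1 : R) ^ (finRotate m i : ℕ) = - (-1) ^ (i : ℕ) := by
  cases m with
  | zero => exact i.elim0
  | succ m =>
    rw [coe_finRotate]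
    split_ifs with h
    · subst h
      have : Odd m := by
        rcases Nat.even_or_odd m with h | h
        · exact absurd hm (by simpa [Nat.even_add_one] using h)
        · exact h
      simp [this.neg_one_pow]
    · rw [pow_succ]
      simp

@[simp]
theorem diskRotation_inl (n : ℕ) {X : Type} (c : X) (k : Fin 4) :
    diskRotation n X (Sum.inl (c, k)) = Sum.inl (c, k + 1) := by
  simp [diskRotation]

@[simp]
theorem diskRotation_inr (n : ℕ) {X : Type} (i : Fin (2 * n)) :
    diskRotation n X (Sum.inr i) = Sum.inr ((finRotate (2 * n)).symm i) := rfl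

variable {n : ℕ} {X : Type} [Fintype X] {R : Type*} [CommRing R]

/-- An invariant `f` is constant around each crossing and along the whole boundary circle, so it
factors out of each vertex sum. -/
theorem sum_mul_eq_zero_of_vertex_sums {f z : HalfEdge n X → R}
    (hf : ∀ d, f (diskRotation n X d) = f d) (hX : ∀ c, ∑ k, z (Sum.inl (c, k)) = 0)
    (hb : ∑ i, z (Sum.inr i) = 0) : ∑ d, f d * z d = 0 := by
  have h₁ : ∀ c k, f (Sum.inl (c, k)) = f (Sum.inl (c, 0)) := fun c k =>
    eq_of_finRotate_invariant (g := fun k => f (Sum.inl (c, k)))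
      (fun k => by simpa using hf (Sum.inl (c, k))) k 0
  have h₂ : ∀ i j : Fin (2 * n), f (Sum.inr i) = f (Sum.inr j) :=
    eq_of_finRotate_invariant (g := fun i => f (Sum.inr i))
      (fun i => by
        have := hf (Sum.inr (finRotate _ i))
        rw [diskRotation_inr, Equiv.symm_apply_apply] at this
        exact this.symm)
  rw [Fintype.sum_sum_type, Fintype.sum_prod_type]
  have h₃ : ∑ i, f (Sum.inr i) * z (Sum.inr i) = 0 := by
    rcases n with _ | n
    · simp
    · rw [Finset.sum_congr rfl fun i _ => by rw [h₂ i ⟨0, by omega⟩], ← Finset.mul_sum, hb,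
        mul_zero]
  rw [h₃, add_zero]
  refine Finset.sum_eq_zero fun c _ => ?_
  rw [Finset.sum_congr rfl fun k _ => by rw [h₁ c k], ← Finset.mul_sum, hX, mul_zero]

theorem vertex_sums_of_sum_mul_eq_zero {z : HalfEdge n X → R}
    (h : ∀ f : HalfEdge n X → R, (∀ d, f (diskRotation n X d) = f d) → ∑ d, f d * z d = 0) :
    (∀ c, ∑ k, z (Sum.inl (c, k)) = 0) ∧ ∑ i, z (Sum.inr i) = 0 := by
  classical
  constructor
  · intro c
    have := h (Sum.elim (fun q => if q.1 = c then 1 else 0) 0) (by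
      rintro (⟨c', k⟩ | i) <;> simp)
    rw [Fintype.sum_sum_type, Fintype.sum_prod_type, Finset.sum_eq_single c] at this
    · simpa using this
    · intro c' _ hc
      simp [hc]
    · simp
  · have := h (Sum.elim 0 1) (by rintro (⟨c', k⟩ | i) <;> simp)
    simpa [Fintype.sum_sum_type] using this

end Rotation

/-! ### Checkerboard signs and the alternating condition -/

namespace TangleDiagram

variable {n : ℕ} (T : TangleDiagram n)

/-- The colorings of the half-edges that come from Fox colorings of the arcs. -/
def halfEdgeColorings (k : ℕ) : Submodule (ZMod k) (HalfEdge n T.Crossing → ZMod k) where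
  carrier := {x | (∀ d, x (T.edge d) = x d) ∧ ∀ c, x (Sum.inl (c, 3)) = x (Sum.inl (c, 1)) ∧
    x (Sum.inl (c, 0)) + x (Sum.inl (c, 2)) = 2 * x (Sum.inl (c, 1))}
  add_mem' := by
    rintro x y ⟨hx, hx'⟩ ⟨hy, hy'⟩
    refine ⟨fun d => by simp [hx, hy], fun c => ⟨by simp [(hx' c).1, (hy' c).1], ?_⟩⟩
    simp only [Pi.add_apply]
    linear_combination (hx' c).2 + (hy' c).2
  zero_mem' := by simp
  smul_mem' := by
    rintro a x ⟨hx, hx'⟩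
    refine ⟨fun d => by simp [hx], fun c => ⟨by simp [(hx' c).1], ?_⟩⟩
    simp only [Pi.smul_apply, smul_eq_mul]
    linear_combination a * (hx' c).2

theorem range_psi (k : ℕ) : LinearMap.range (T.psi k) =
    (T.halfEdgeColorings k).map (LinearMap.funLeft (ZMod k) (ZMod k) Sum.inr) := by
  ext a
  constructor
  · rintro ⟨⟨x, hx⟩, rfl⟩
    refine ⟨fun d => x (T.arc d), ⟨fun d => ?_, fun c => ⟨?_, hx c⟩⟩, rfl⟩
    · exact congrArg (fun q => x (Sum.inl q)) (Quot.sound (ArcStep.along d)).symm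
    · exact congrArg (fun q => x (Sum.inl q)) (Quot.sound (ArcStep.over c)).symm
  · rintro ⟨x, ⟨hx, hx'⟩, rfl⟩
    -- Closed components without crossings are unconstrained and do not meet the boundary; they get
    -- color 0.
    refine ⟨⟨Sum.elim (Quot.lift x ?_) 0, fun c => (hx' c).2⟩, rfl⟩
    rintro a _ (_ | c)
    · exact (hx a).symm
    · exact (hx' c).1.symm

/-- Vertex degrees are 4 and `2 * n`, all even, so the constant 1 is a circulation modulo 2. A
potential for it changes across every edge, and so colors the faces in two colors. -/
theorem exists_checkerboard (R : Type*) [CommRing R] :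
    ∃ s : HalfEdge n T.Crossing → R, (∀ d, s d * s d = 1) ∧
      (∀ d, s (diskRotation n T.Crossing d) = - s d) ∧ ∀ d, s (T.edge d) = - s d := by
  classical
  have := T.finite_crossing
  have := Fintype.ofFinite T.Crossing
  obtain ⟨u, hu, hu'⟩ := T.planar.exists_potential T.edge_edge T.edge_ne (K := ZMod 2)
    (z := 1) (fun d => by simp) (fun f hf => sum_mul_eq_zero_of_vertex_sums hf
      (fun c => by simp; decide) (by simp; left; decide))
  have hne : ∀ d, u (diskRotation n T.Crossing d) = u d + 1 := by
    intro d
    have := hu' d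
    rw [Pi.one_apply] at this
    linear_combination this - CharTwo.two_eq_zero (R := ZMod 2)
  have key : ∀ a : ZMod 2, (if a + 1 = 0 then (1 : R) else -1) = -(if a = 0 then 1 else -1) := by
    intro a
    rcases (by decide : ∀ a : ZMod 2, a = 0 ∨ a = 1) a with rfl | rfl
    · simp
    · rw [if_pos (by decide), if_neg (by decide), neg_neg]
  refine ⟨fun d => if u d = 0 then 1 else -1, fun d => ?_, fun d => ?_, fun d => ?_⟩
  · dsimp only
    split_ifs <;> simp
  · simp only [hne, key]
  · simp only [← hu, hne, key]

variable {T}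

/-- Both `s` and `(-1) ^ (i + 1)` change sign at each step along the boundary, so their product is
constant. -/
theorem exists_boundary_sign {R : Type*} [CommRing R] {s : HalfEdge n T.Crossing → R}
    (hs : ∀ d, s d * s d = 1) (hr : ∀ d, s (diskRotation n T.Crossing d) = - s d) :
    ∃ c : R, c * c = 1 ∧ ∀ i : Fin (2 * n), s (Sum.inr i) = c * (-1) ^ ((i : ℕ) + 1) := by
  rcases n with _ | n
  · exact ⟨1, by simp, fun i => i.elim0⟩
  have h := eq_of_finRotate_invariant (g := fun i : Fin (2 * (n + 1)) =>
    s (Sum.inr i) * (-1) ^ ((i : ℕ) + 1)) (fun i => by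
      have := hr (Sum.inr (finRotate _ i))
      rw [diskRotation_inr, Equiv.symm_apply_apply] at this
      rw [this, pow_succ, pow_succ, neg_one_pow_finRotate (even_two_mul _)]
      ring)
  have hsq : ∀ k : ℕ, (-1 : R) ^ k * (-1) ^ k = 1 := fun k => by rw [← mul_pow]; simp
  refine ⟨s (Sum.inr 0) * (-1) ^ ((0 : Fin (2 * (n + 1))).val + 1), ?_, fun i => ?_⟩
  · linear_combination (s (Sum.inr 0) * s (Sum.inr 0)) * hsq _ + hs (Sum.inr 0)
  · rw [← h i 0]
    linear_combination - s (Sum.inr i) * hsq ((i : ℕ) + 1)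

theorem crossing_sign {R : Type*} [CommRing R] {s : HalfEdge n T.Crossing → R}
    (hr : ∀ d, s (diskRotation n T.Crossing d) = - s d) (c : T.Crossing) :
    s (Sum.inl (c, 1)) = - s (Sum.inl (c, 0)) ∧ s (Sum.inl (c, 2)) = s (Sum.inl (c, 0)) ∧
      s (Sum.inl (c, 3)) = - s (Sum.inl (c, 0)) := by
  have h₀ := hr (Sum.inl (c, 0))
  have h₁ := hr (Sum.inl (c, 1))
  have h₂ := hr (Sum.inl (c, 2))
  simp only [diskRotation_inl, Fin.isValue, zero_add, Fin.reduceAdd] at h₀ h₁ h₂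
  exact ⟨h₀, by rw [h₁, h₀, neg_neg], by rw [h₂, h₁, h₀, neg_neg]⟩

theorem sum_crossing_sign_mul_coloring {k : ℕ} {s x : HalfEdge n T.Crossing → ZMod k}
    (hr : ∀ d, s (diskRotation n T.Crossing d) = - s d) (hx : x ∈ T.halfEdgeColorings k)
    (c : T.Crossing) : ∑ j, s (Sum.inl (c, j)) * x (Sum.inl (c, j)) = 0 := by
  obtain ⟨h₁, h₂, h₃⟩ := crossing_sign hr c
  obtain ⟨h, h'⟩ := hx.2 c
  rw [Fin.sum_univ_four, h₁, h₂, h₃, h]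
  linear_combination s (Sum.inl (c, 0)) * h'

/-- The sum of `s * x` over all half-edges cancels along edges, and the part at each crossing is
already zero. -/
theorem sum_boundary_sign_mul_coloring {p : ℕ} [Fact p.Prime]
    {s x : HalfEdge n T.Crossing → ZMod p}
    (hr : ∀ d, s (diskRotation n T.Crossing d) = - s d) (he : ∀ d, s (T.edge d) = - s d)
    (hx : x ∈ T.halfEdgeColorings p) : ∑ i, s (Sum.inr i) * x (Sum.inr i) = 0 := by
  have := T.finite_crossing
  have := Fintype.ofFinite T.Crossing
  have h := mem_dotPerp.mp ((mem_dotPerp_invariantFunctions_involution (z := s * x)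
    T.edge_edge T.edge_ne).mpr fun d => by simp [he, hx.1 d]) 1
    (mem_invariantFunctions_singleton.mpr fun _ => rfl)
  simpa [Fintype.sum_sum_type, Fintype.sum_prod_type, sum_crossing_sign_mul_coloring hr hx]
    using h

theorem range_psi_le_alternatingColorings (p : ℕ) [Fact p.Prime] :
    LinearMap.range (T.psi p) ≤ alternatingColorings p n := by
  rw [range_psi]
  rintro _ ⟨x, hx, rfl⟩
  obtain ⟨s, hs, hr, he⟩ := T.exists_checkerboard (ZMod p)
  obtain ⟨c, hc, hsc⟩ := exists_boundary_sign hs hr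
  have h := sum_boundary_sign_mul_coloring hr he hx
  simp only [hsc, mul_assoc, ← Finset.mul_sum] at h
  change ∑ i : Fin (2 * n), (-1) ^ ((i : ℕ) + 1) * x (Sum.inr i) = 0
  linear_combination c * h - hc * ∑ i : Fin (2 * n), (-1) ^ ((i : ℕ) + 1) * x (Sum.inr i)

end TangleDiagram

/-! ### The skew form on the boundary circle -/

section CentralDifference

variable {D : Type} {K : Type} [Field K]

variable (K) in
/-- The difference of the values at the successor and at the predecessor. -/
def centralDifference (σ : Equiv.Perm D) : (D → K) →ₗ[K] (D → K) :=
  LinearMap.funLeft K K σ - LinearMap.funLeft K K σ.symm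

theorem centralDifference_apply (σ : Equiv.Perm D) (u : D → K) (d : D) :
    centralDifference K σ u d = u (σ d) - u (σ.symm d) := rfl

theorem apply_apply_of_mem_ker_centralDifference {σ : Equiv.Perm D} {u : D → K}
    (hu : u ∈ LinearMap.ker (centralDifference K σ)) (d : D) : u (σ (σ d)) = u d := by
  have := congrFun (LinearMap.mem_ker.mp hu) (σ d)
  rw [centralDifference_apply, Equiv.symm_apply_apply] at this
  exact sub_eq_zero.mp this

/-- Both halves of the difference reindex to `∑ d, u d * v (edge d)`. -/
theorem sum_mul_centralDifference_eq_zero [Fintype D] {rot edge : Equiv.Perm D}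
    (hee : ∀ d, edge (edge d) = d) {u v : D → K} (hu : ∀ d, u (rot d) = u (edge d))
    (hv : ∀ d, v (rot d) = v (edge d)) : ∑ d, u d * centralDifference K rot v d = 0 := by
  simp only [centralDifference_apply, mul_sub, Finset.sum_sub_distrib, sub_eq_zero]
  rw [← Equiv.sum_comp rot (fun d => u d * v (rot.symm d)), ← Equiv.sum_comp edge]
  simp [hu, hv, hee]

theorem finrank_ker_centralDifference_finRotate_le (m : ℕ) :
    finrank K (LinearMap.ker (centralDifference K (finRotate (m + 1)).symm)) ≤ 2 := by
  let ev : (Fin (m + 1) → K) →ₗ[K] (Fin 2 → K) := LinearMap.funLeft K K ![0, finRotate _ 0]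
  have h := LinearMap.finrank_le_finrank_of_injective
    (f := ev.domRestrict (LinearMap.ker (centralDifference K (finRotate (m + 1)).symm))) (by
      rw [← LinearMap.ker_eq_bot, LinearMap.ker_eq_bot']
      rintro ⟨w, hw⟩ h
      have h₀ : w 0 = 0 := congrFun h 0
      have h₁ : w (finRotate _ 0) = 0 := congrFun h 1
      have h₂ : ∀ i, w (finRotate _ (finRotate _ i)) = w i := fun i => by
        have := apply_apply_of_mem_ker_centralDifference hw (finRotate _ (finRotate _ i))
        rw [Equiv.symm_apply_apply, Equiv.symm_apply_apply] at this
        exact this.symm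
      -- Vanishing at two consecutive points is a rotation-invariant property, because `w` has
      -- period 2.
      have h₃ := eq_of_finRotate_invariant (g := fun i => w i = 0 ∧ w (finRotate _ i) = 0)
        (fun i => by rw [h₂]; exact propext and_comm)
      ext i
      exact ((h₃ i 0).mpr ⟨h₀, h₁⟩).1)
  simpa using h

/-- The central difference maps `W` into its orthogonal complement and has a kernel of dimension at
most 2. -/
theorem two_mul_finrank_le_of_isotropic {m : ℕ} {W : Submodule K (Fin (m + 1) → K)}
    (hW : ∀ v ∈ W, ∀ w ∈ W, ∑ i, v i * centralDifference K (finRotate (m + 1)).symm w i = 0) :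
    2 * finrank K W ≤ m + 3 := by
  have h₁ := W.finrank_map_add_finrank_inf_ker (centralDifference K (finRotate (m + 1)).symm)
  have h₂ : W.map (centralDifference K (finRotate (m + 1)).symm) ≤ dotPerp W := by
    rintro _ ⟨w, hw, rfl⟩ v hv
    exact hW v hv w hw
  have h₃ := Submodule.finrank_mono h₂
  have h₄ := finrank_dotPerp W
  have h₅ := (Submodule.finrank_mono (inf_le_right (a := W))).trans
    (finrank_ker_centralDifference_finRotate_le (K := K) m)
  rw [Fintype.card_fin] at h₄
  omega

end CentralDifference

/-! ### Potentials and the dimension of the space of boundary colorings -/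

namespace TangleDiagram

variable {n : ℕ} (T : TangleDiagram n) (K : Type) [Field K]

/-- Functions on the faces whose signed differences across the arcs are Fox colorings. -/
def potentials : Submodule K (HalfEdge n T.Crossing → K) where
  carrier := {u | (∀ d, u (diskRotation n T.Crossing d) = u (T.edge d)) ∧
    ∀ c, u (Sum.inl (c, 0)) + u (Sum.inl (c, 1)) = u (Sum.inl (c, 2)) + u (Sum.inl (c, 3))}
  add_mem' := by
    rintro x y ⟨hx, hx'⟩ ⟨hy, hy'⟩
    refine ⟨fun d => by simp [hx, hy], fun c => ?_⟩
    simp only [Pi.add_apply]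
    linear_combination hx' c + hy' c
  zero_mem' := by simp
  smul_mem' := by
    rintro a x ⟨hx, hx'⟩
    refine ⟨fun d => by simp [hx], fun c => ?_⟩
    simp only [Pi.smul_apply, smul_eq_mul]
    linear_combination a * hx' c

/-- The values of the potentials at the faces along the boundary circle. -/
def boundaryPotentials : Submodule K (Fin (2 * n) → K) :=
  (T.potentials K).map (LinearMap.funLeft K K Sum.inr)

variable {K} in
/-- The signed differences of adjacent values along the boundary circle. -/
def signedDifference (s : Fin (2 * n) → K) : (Fin (2 * n) → K) →ₗ[K] (Fin (2 * n) → K) where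
  toFun w i := s i * (w i - w ((finRotate (2 * n)).symm i))
  map_add' v w := by ext i; simp only [Pi.add_apply]; ring
  map_smul' a w := by ext i; simp only [Pi.smul_apply, smul_eq_mul, RingHom.id_apply]; ring

variable {T K}

/-- Planarity gives a potential for `s * x`. Both coloring conditions at a crossing then become, up
to sign, the one equation in `potentials`. -/
theorem range_psi_eq_map_boundaryPotentials {p : ℕ} [Fact p.Prime]
    {s : HalfEdge n T.Crossing → ZMod p} (hs : ∀ d, s d * s d = 1)
    (hr : ∀ d, s (diskRotation n T.Crossing d) = - s d) (he : ∀ d, s (T.edge d) = - s d) :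
    LinearMap.range (T.psi p) = (T.boundaryPotentials (ZMod p)).map
      (signedDifference fun i => s (Sum.inr i)) := by
  have := T.finite_crossing
  have := Fintype.ofFinite T.Crossing
  rw [range_psi]
  ext a
  constructor
  · rintro ⟨x, hx, rfl⟩
    obtain ⟨u, hu, hu'⟩ := T.planar.exists_potential T.edge_edge T.edge_ne
      (z := fun d => s d * x d) (fun d => by simp [he, hx.1 d])
      (fun f hf => sum_mul_eq_zero_of_vertex_sums hf (sum_crossing_sign_mul_coloring hr hx)
        (sum_boundary_sign_mul_coloring hr he hx))
    have hx' : ∀ d, s d * (u d - u (diskRotation n T.Crossing d)) = x d := fun d => by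
      rw [← hu' d, ← mul_assoc, hs, one_mul]
    refine ⟨fun i => u (Sum.inr i), ⟨u, ⟨hu, fun c => ?_⟩, rfl⟩, ?_⟩
    · obtain ⟨h₁, h₂, h₃⟩ := crossing_sign hr c
      have h := (hx.2 c).1
      rw [← hx', ← hx', h₁, h₃] at h
      simp only [diskRotation_inl, Fin.isValue, Fin.reduceAdd] at h
      linear_combination s (Sum.inl (c, 0)) * h + (u (Sum.inl (c, 2)) + u (Sum.inl (c, 3)) -
        u (Sum.inl (c, 0)) - u (Sum.inl (c, 1))) * hs (Sum.inl (c, 0))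
    · ext i
      exact hx' (Sum.inr i)
  · rintro ⟨_, ⟨u, ⟨hu, hu'⟩, rfl⟩, rfl⟩
    refine ⟨fun d => s d * (u d - u (diskRotation n T.Crossing d)),
      ⟨fun d => ?_, fun c => ?_⟩, rfl⟩
    · dsimp only
      rw [he, hu (T.edge d), T.edge_edge, ← hu]
      ring
    · obtain ⟨h₁, h₂, h₃⟩ := crossing_sign hr c
      simp only [h₁, h₂, h₃, diskRotation_inl, Fin.isValue, Fin.reduceAdd, zero_add]
      constructor
      · linear_combination s (Sum.inl (c, 0)) * hu' c
      · linear_combination s (Sum.inl (c, 0)) * hu' c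

/-- The kernel consists of the constants, which are boundary values of constant potentials. -/
theorem finrank_map_signedDifference (hn : 1 ≤ n) {s : Fin (2 * n) → K}
    (hs : ∀ i, s i * s i = 1) :
    finrank K ((T.boundaryPotentials K).map (signedDifference s)) + 1 =
      finrank K (T.boundaryPotentials K) := by
  have h := (T.boundaryPotentials K).finrank_map_add_finrank_inf_ker (signedDifference s)
  have hk : T.boundaryPotentials K ⊓ LinearMap.ker (signedDifference s) =
      Submodule.span K {fun _ => (1 : K)} := by
    ext w
    rw [Submodule.mem_inf, Submodule.mem_span_singleton, LinearMap.mem_ker]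
    constructor
    · rintro ⟨-, hw⟩
      have h₁ : ∀ i, w (finRotate _ i) = w i := fun i => by
        have := congrFun hw (finRotate _ i)
        change s (finRotate _ i) * (w (finRotate _ i) - w ((finRotate _).symm _)) = 0 at this
        rw [Equiv.symm_apply_apply] at this
        linear_combination s (finRotate _ i) * this
          - (w (finRotate _ i) - w i) * hs (finRotate _ i)
      refine ⟨w ⟨0, by omega⟩, ?_⟩
      ext i
      simpa using eq_of_finRotate_invariant h₁ _ i
    · rintro ⟨a, rfl⟩
      refine ⟨⟨fun _ => a, ⟨fun _ => rfl, fun _ => rfl⟩, ?_⟩, ?_⟩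
      · ext i
        simp [LinearMap.funLeft_apply]
      · ext i
        simp [signedDifference]
  rwa [hk, finrank_span_singleton] at h
  exact fun h0 => one_ne_zero (congrFun h0 ⟨0, by omega⟩)

/-- With `g = u (c, 1) - u (c, 3)` the values are `g, g, -g, -g`: a multiple of the coefficients of
the crossing equation. Both dimension bounds rest on this. -/
theorem centralDifference_crossing {u : HalfEdge n T.Crossing → K} (hu : u ∈ T.potentials K)
    (c : T.Crossing) :
    centralDifference K (diskRotation n T.Crossing) u (Sum.inl (c, 0)) =
        u (Sum.inl (c, 1)) - u (Sum.inl (c, 3)) ∧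
      centralDifference K (diskRotation n T.Crossing) u (Sum.inl (c, 1)) =
        u (Sum.inl (c, 1)) - u (Sum.inl (c, 3)) ∧
      centralDifference K (diskRotation n T.Crossing) u (Sum.inl (c, 2)) =
        -(u (Sum.inl (c, 1)) - u (Sum.inl (c, 3))) ∧
      centralDifference K (diskRotation n T.Crossing) u (Sum.inl (c, 3)) =
        -(u (Sum.inl (c, 1)) - u (Sum.inl (c, 3))) := by
  have hsymm : ∀ k, (diskRotation n T.Crossing).symm (Sum.inl (c, k + 1)) = Sum.inl (c, k) :=
    fun k => by rw [Equiv.symm_apply_eq, diskRotation_inl]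
  have h₃ := hsymm 3
  have h₀ := hsymm 0
  have h₁ := hsymm 1
  have h₂ := hsymm 2
  simp only [Fin.isValue, Fin.reduceAdd, zero_add] at h₀ h₁ h₂ h₃
  simp only [centralDifference_apply, diskRotation_inl, Fin.isValue, Fin.reduceAdd, zero_add,
    h₀, h₁, h₂, h₃]
  have := hu.2 c
  exact ⟨trivial, by linear_combination -this, by ring, by linear_combination this⟩

/-- The skew form summed over all half-edges vanishes on face functions. For potentials each
crossing contributes zero, so the boundary part vanishes too and the boundary values are isotropic.
-/
theorem finrank_boundaryPotentials_le (hn : 1 ≤ n) :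
    finrank K (T.boundaryPotentials K) ≤ n + 1 := by
  have := T.finite_crossing
  have := Fintype.ofFinite T.Crossing
  obtain ⟨n, rfl⟩ := Nat.exists_eq_add_of_le' hn
  have h := two_mul_finrank_le_of_isotropic (m := 2 * n + 1) (W := T.boundaryPotentials K) (by
    rintro _ ⟨u, hu, rfl⟩ _ ⟨v, hv, rfl⟩
    have h := sum_mul_centralDifference_eq_zero T.edge_edge hu.1 hv.1
    rw [Fintype.sum_sum_type, Fintype.sum_prod_type] at h
    rwa [Finset.sum_eq_zero, zero_add] at h
    intro c _
    obtain ⟨h₀, h₁, h₂, h₃⟩ := centralDifference_crossing hv c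
    rw [Fin.sum_univ_four, h₀, h₁, h₂, h₃]
    linear_combination (v (Sum.inl (c, 1)) - v (Sum.inl (c, 3))) * hu.2 c)
  change 2 * finrank K (T.boundaryPotentials K) ≤ _ at h
  omega

variable (T K) in
/-- The functions that express the crossing condition for potentials by the dot product. -/
def crossingFunctions : (T.Crossing → K) →ₗ[K] (HalfEdge n T.Crossing → K) where
  toFun l := Sum.elim (fun q => l q.1 * ![1, 1, -1, -1] q.2) 0
  map_add' l l' := by ext (q | i) <;> simp [add_mul]
  map_smul' a l := by ext (q | i) <;> simp [mul_assoc]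

theorem potentials_eq_dotPerp [Fintype T.Crossing] : T.potentials K =
    dotPerp (dotPerp (invariantFunctions K {diskRotation n T.Crossing * T.edge}) ⊔
      LinearMap.range (T.crossingFunctions K)) := by
  classical
  rw [dotPerp_sup, dotPerp_dotPerp]
  ext u
  rw [Submodule.mem_inf, mem_invariantFunctions_face T.edge_edge, mem_dotPerp]
  refine and_congr_right fun _ => ⟨?_, fun h c => ?_⟩
  · rintro h _ ⟨l, rfl⟩
    rw [Fintype.sum_sum_type, Fintype.sum_prod_type]
    simp only [crossingFunctions, LinearMap.coe_mk, AddHom.coe_mk, Sum.elim_inl, Sum.elim_inr,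
      Pi.zero_apply, zero_mul, Finset.sum_const_zero, add_zero]
    refine Finset.sum_eq_zero fun c _ => ?_
    simp only [Fin.sum_univ_four, Matrix.cons_val]
    linear_combination l c * h c
  · have := h _ ⟨Pi.single c 1, rfl⟩
    rw [Fintype.sum_sum_type, Fintype.sum_prod_type, Finset.sum_eq_single c] at this
    · simp only [crossingFunctions, LinearMap.coe_mk, AddHom.coe_mk, Sum.elim_inl, Sum.elim_inr,
        Pi.zero_apply, zero_mul, Finset.sum_const_zero, add_zero, Fin.sum_univ_four,
        Matrix.cons_val, Pi.single_eq_same] at this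
      linear_combination this
    · intro c' _ hc
      simp [crossingFunctions, hc]
    · simp

theorem numOrbits_diskRotation_le [Fintype T.Crossing] (hn : 1 ≤ n) :
    numOrbits {diskRotation n T.Crossing} ≤ Fintype.card T.Crossing + 1 := by
  rw [← finrank_invariantFunctions (K := ℚ)]
  let ev : (HalfEdge n T.Crossing → ℚ) →ₗ[ℚ] (Option T.Crossing → ℚ) :=
    LinearMap.funLeft ℚ ℚ fun o => o.elim (Sum.inr ⟨0, by omega⟩) fun c => Sum.inl (c, 0)
  have h := LinearMap.finrank_le_finrank_of_injective
    (f := ev.domRestrict (invariantFunctions ℚ {diskRotation n T.Crossing})) (by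
      rw [← LinearMap.ker_eq_bot, LinearMap.ker_eq_bot']
      rintro ⟨f, hf⟩ h
      rw [mem_invariantFunctions_singleton] at hf
      ext (⟨c, k⟩ | i)
      · refine (eq_of_finRotate_invariant (g := fun k => f (Sum.inl (c, k)))
          (fun k => ?_) k 0).trans (congrFun h (some c))
        simpa using hf (Sum.inl (c, k))
      · refine (eq_of_finRotate_invariant (g := fun i => f (Sum.inr i))
          (fun i => ?_) i _).trans (congrFun h none)
        have := hf (Sum.inr (finRotate _ i))
        rw [diskRotation_inr, Equiv.symm_apply_apply] at this
        exact this.symm)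
  simpa using h

/-- The value of a function on the faces at a neighbouring face of positive sign. -/
def positiveFaceValue (s : HalfEdge n T.Crossing → ℤ) :
    (HalfEdge n T.Crossing → K) →ₗ[K] (HalfEdge n T.Crossing → K) :=
  LinearMap.funLeft K K fun d => if s d = 1 then d else diskRotation n T.Crossing d

/-- In the kernel of the central difference, opposite faces at a vertex have equal values, so the
value on faces of one sign does not change within a component. -/
theorem positiveFaceValue_invariant {s : HalfEdge n T.Crossing → ℤ}
    (hs : ∀ d, s d * s d = 1) (hr : ∀ d, s (diskRotation n T.Crossing d) = - s d)
    (he : ∀ d, s (T.edge d) = - s d) {u : HalfEdge n T.Crossing → K}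
    (hu : ∀ d, u (diskRotation n T.Crossing d) = u (T.edge d))
    (hu' : u ∈ LinearMap.ker (centralDifference K (diskRotation n T.Crossing))) :
    positiveFaceValue s u ∈ invariantFunctions K {diskRotation n T.Crossing, T.edge} := by
  have h := apply_apply_of_mem_ker_centralDifference hu'
  rw [mem_invariantFunctions_pair]
  simp only [positiveFaceValue, LinearMap.funLeft_apply, hr, he]
  constructor <;> intro d <;> rcases mul_self_eq_one_iff.mp (hs d) with hd | hd <;>
    simp [hd, h, hu, T.edge_edge]

/-- Such a function is determined by one value for each component and each sign, and on the
component of the boundary both values are zero. -/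
theorem finrank_ker_centralDifference_le [Fintype T.Crossing] (hn : 1 ≤ n) :
    finrank K ((T.potentials K ⊓ LinearMap.ker (LinearMap.funLeft K K Sum.inr)) ⊓
      LinearMap.ker (centralDifference K (diskRotation n T.Crossing)) :
        Submodule K (HalfEdge n T.Crossing → K)) + 2 ≤
      2 * numOrbits {diskRotation n T.Crossing, T.edge} := by
  obtain ⟨s, hs, hr, he⟩ := T.exists_checkerboard ℤ
  set M := (T.potentials K ⊓ LinearMap.ker (LinearMap.funLeft K K Sum.inr)) ⊓
      LinearMap.ker (centralDifference K (diskRotation n T.Crossing)) with hM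
  let I₀ : Submodule K (HalfEdge n T.Crossing → K) :=
    invariantFunctions K {diskRotation n T.Crossing, T.edge} ⊓
      LinearMap.ker (LinearMap.proj (Sum.inr ⟨0, by omega⟩))
  have hI : finrank K I₀ < numOrbits {diskRotation n T.Crossing, T.edge} := by
    rw [← finrank_invariantFunctions (K := K)]
    refine Submodule.finrank_lt_finrank_of_lt (lt_of_le_of_ne inf_le_left fun h => ?_)
    have h₁ : (1 : HalfEdge n T.Crossing → K) ∈
        invariantFunctions K {diskRotation n T.Crossing, T.edge} := fun _ _ _ => rfl
    rw [← h] at h₁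
    exact one_ne_zero h₁.2
  have hmap : ∀ t : HalfEdge n T.Crossing → ℤ, (∀ d, t d * t d = 1) →
      (∀ d, t (diskRotation n T.Crossing d) = - t d) → (∀ d, t (T.edge d) = - t d) →
      M.map (positiveFaceValue t) ≤ I₀ := by
    rintro t ht htr hte _ ⟨u, ⟨⟨hu, hb⟩, hc⟩, rfl⟩
    refine ⟨positiveFaceValue_invariant ht htr hte hu.1 hc, ?_⟩
    have hb' : ∀ i, u (Sum.inr i) = 0 := congrFun hb
    change u (if _ then _ else _) = 0
    split_ifs
    · exact hb' _
    · rw [diskRotation_inr, hb']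
  have h₁ := M.finrank_map_add_finrank_inf_ker (positiveFaceValue s)
  have h₂ := (M ⊓ LinearMap.ker (positiveFaceValue s)).finrank_map_add_finrank_inf_ker
    (positiveFaceValue (-s))
  have h₃ : (M ⊓ LinearMap.ker (positiveFaceValue s)) ⊓
      LinearMap.ker (positiveFaceValue (K := K) (-s)) = ⊥ := by
    rw [eq_bot_iff]
    rintro u ⟨⟨-, h⟩, h'⟩
    rw [Submodule.mem_bot]
    ext d
    have h := congrFun h d
    have h' := congrFun h' d
    simp only [positiveFaceValue, LinearMap.funLeft_apply, Pi.neg_apply, Pi.zero_apply] at h h'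
    rcases mul_self_eq_one_iff.mp (hs d) with hd | hd
    · simpa [hd] using h
    · simpa [hd] using h'
  rw [h₃, finrank_bot] at h₂
  have h₄ := Submodule.finrank_mono (hmap s hs hr he)
  have h₅ := Submodule.finrank_mono ((Submodule.map_mono inf_le_left).trans
    (hmap (-s) (by simpa using hs) (by simp [hr]) (by simp [he])) :
      (M ⊓ LinearMap.ker (positiveFaceValue s)).map (positiveFaceValue (-s)) ≤ I₀)
  omega

/-- Let `c` be the number of crossings. The potentials have dimension at least `F - c + dim (dotPerp
Φ ⊓ N)`. The central difference maps the potentials `A` with zero boundary values into `dotPerp Φ ⊓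
N`, with kernel of dimension at most `2 * C - 2`. Hence the boundary values have dimension at least
`F - c - 2 * C + 2`, which is at least `n + 1` by Euler's formula with `E = 2 * c + n` and `V ≤ c +
1`. -/
theorem le_finrank_boundaryPotentials (hn : 1 ≤ n) :
    n + 1 ≤ finrank K (T.boundaryPotentials K) := by
  have := T.finite_crossing
  have := Fintype.ofFinite T.Crossing
  set Φ := invariantFunctions K {diskRotation n T.Crossing * T.edge}
  set N := LinearMap.range (T.crossingFunctions K)
  set A := T.potentials K ⊓ LinearMap.ker (LinearMap.funLeft K K Sum.inr)
  have h₁ := finrank_dotPerp (dotPerp Φ ⊔ N)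
  rw [← potentials_eq_dotPerp] at h₁
  have h₂ := Submodule.finrank_sup_add_finrank_inf_eq (dotPerp Φ) N
  have h₃ := finrank_dotPerp Φ
  have hF : finrank K Φ = _ := finrank_invariantFunctions _
  have hN : finrank K N ≤ Fintype.card T.Crossing :=
    (LinearMap.finrank_range_le _).trans_eq (finrank_fintype_fun_eq_card K)
  have h₄ : finrank K (T.boundaryPotentials K) + finrank K A = finrank K (T.potentials K) :=
    (T.potentials K).finrank_map_add_finrank_inf_ker (LinearMap.funLeft K K Sum.inr)
  have h₅ := A.finrank_map_add_finrank_inf_ker (centralDifference K (diskRotation n T.Crossing))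
  have h₆ : A.map (centralDifference K (diskRotation n T.Crossing)) ≤ dotPerp Φ ⊓ N := by
    rintro _ ⟨u, ⟨hu, hb⟩, rfl⟩
    have hb' : ∀ i, u (Sum.inr i) = 0 := congrFun hb
    refine ⟨fun v hv => sum_mul_centralDifference_eq_zero T.edge_edge
      ((mem_invariantFunctions_face T.edge_edge).mp hv) hu.1,
      fun c => u (Sum.inl (c, 1)) - u (Sum.inl (c, 3)), ?_⟩
    ext (⟨c, k⟩ | i)
    · obtain ⟨h₀, h₁, h₂, h₃⟩ := centralDifference_crossing hu c
      fin_cases k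
      · simpa [crossingFunctions] using h₀.symm
      · simpa [crossingFunctions] using h₁.symm
      · simpa [crossingFunctions] using h₂.symm
      · simpa [crossingFunctions] using h₃.symm
    · change 0 = u (Sum.inr _) - u (Sum.inr _)
      rw [hb', hb', sub_zero]
  have h₇ := Submodule.finrank_mono h₆
  have h₈ := finrank_ker_centralDifference_le (T := T) (K := K) hn
  have h₉ := numOrbits_diskRotation_le (T := T) hn
  have hE := two_mul_numOrbits_involution T.edge_edge T.edge_ne
  have hP := T.planar
  have hH : Fintype.card (HalfEdge n T.Crossing) = 4 * Fintype.card T.Crossing + 2 * n := by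
    simp [mul_comm]
  rw [IsPlanarMap] at hP
  change finrank K (A ⊓ _ : Submodule K _) + 2 ≤ _ at h₈
  omega

theorem finrank_range_psi (p : ℕ) [Fact p.Prime] (hn : 1 ≤ n) (T : TangleDiagram n) :
    finrank (ZMod p) (LinearMap.range (T.psi p)) = n := by
  obtain ⟨s, hs, hr, he⟩ := T.exists_checkerboard (ZMod p)
  have h₁ := finrank_map_signedDifference (T := T) hn (s := fun i => s (Sum.inr i))
    fun i => hs (Sum.inr i)
  rw [← range_psi_eq_map_boundaryPotentials hs hr he] at h₁
  have h₂ := finrank_boundaryPotentials_le (T := T) (K := ZMod p) hn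
  have h₃ := le_finrank_boundaryPotentials (T := T) (K := ZMod p) hn
  omega

end TangleDiagram

namespace TangleDiagram

/-! ### Adding a crossing at two neighbouring boundary points -/

section AddCrossing

variable {n : ℕ} (T : TangleDiagram n) (i : Fin (2 * n))

/-- The half-edges of a diagram as half-edges of the diagram with a further crossing `none` of the
strands that end at `i` and at the following boundary point. -/
def crossingEmbedding : HalfEdge n T.Crossing → HalfEdge n (Option T.Crossing)
  | Sum.inl (c, k) => Sum.inl (some c, k)
  | Sum.inr m => if m = i then Sum.inl (none, 3) else
      if m = finRotate _ i then Sum.inl (none, 2) else Sum.inr m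

/-- The edges of the diagram with a further crossing. -/
def crossingEdge : HalfEdge n (Option T.Crossing) → HalfEdge n (Option T.Crossing)
  | Sum.inl (some c, k) => T.crossingEmbedding i (T.edge (Sum.inl (c, k)))
  | Sum.inl (none, 0) => Sum.inr i
  | Sum.inl (none, 1) => Sum.inr (finRotate _ i)
  | Sum.inl (none, 2) => T.crossingEmbedding i (T.edge (Sum.inr (finRotate _ i)))
  | Sum.inl (none, 3) => T.crossingEmbedding i (T.edge (Sum.inr i))
  | Sum.inr m => if m = i then Sum.inl (none, 0) else
      if m = finRotate _ i then Sum.inl (none, 1) else T.crossingEmbedding i (T.edge (Sum.inr m))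

variable {T i}

theorem crossingEmbedding_cases (hi : finRotate _ i ≠ i)
    {P : HalfEdge n (Option T.Crossing) → Prop}
    (h : ∀ d, P (T.crossingEmbedding i d)) (h₀ : P (Sum.inl (none, 0)))
    (h₁ : P (Sum.inl (none, 1))) (hb₀ : P (Sum.inr i)) (hb₁ : P (Sum.inr (finRotate _ i))) :
    ∀ d, P d := by
  rintro (⟨_ | c, k⟩ | m)
  · fin_cases k
    · exact h₀
    · exact h₁
    · simpa [crossingEmbedding, hi, -finRotate_apply] using h (Sum.inr (finRotate _ i))
    · simpa [crossingEmbedding] using h (Sum.inr i)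
  · exact h (Sum.inl (c, k))
  · by_cases hm : m = i
    · exact hm ▸ hb₀
    by_cases hm' : m = finRotate _ i
    · exact hm' ▸ hb₁
    simpa [crossingEmbedding, hm, hm', -finRotate_apply] using h (Sum.inr m)

theorem crossingEdge_crossingEmbedding (d : HalfEdge n T.Crossing) :
    T.crossingEdge i (T.crossingEmbedding i d) = T.crossingEmbedding i (T.edge d) := by
  rcases d with ⟨c, k⟩ | m
  · rfl
  · rw [crossingEmbedding]
    split_ifs with h h'
    · rw [h]; rfl
    · rw [h']; rfl
    · simp only [crossingEdge, if_neg h, if_neg h']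

theorem crossingEdge_inr_self :
    T.crossingEdge i (Sum.inr i) = Sum.inl (none, 0) := by simp [crossingEdge]

theorem crossingEdge_inr_finRotate (hi : finRotate _ i ≠ i) :
    T.crossingEdge i (Sum.inr (finRotate _ i)) = Sum.inl (none, 1) := by
  simp only [crossingEdge, if_neg hi, if_true]

theorem crossingEmbedding_injective :
    Function.Injective (T.crossingEmbedding i) := by
  rintro (⟨c, k⟩ | m) (⟨c', k'⟩ | m') h
  all_goals
    simp only [crossingEmbedding] at h
    try split_ifs at h
    all_goals simp_all

theorem crossingEdge_involutive (hi : finRotate _ i ≠ i) :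
    Function.Involutive (T.crossingEdge i) := by
  refine crossingEmbedding_cases hi (fun d => ?_) ?_ ?_ ?_ ?_
  · rw [crossingEdge_crossingEmbedding, crossingEdge_crossingEmbedding, T.edge_edge]
  · exact crossingEdge_inr_self
  · exact crossingEdge_inr_finRotate hi
  · rw [crossingEdge_inr_self]; rfl
  · rw [crossingEdge_inr_finRotate hi]; rfl

theorem crossingEdge_ne (hi : finRotate _ i ≠ i) (d : HalfEdge n (Option T.Crossing)) :
    T.crossingEdge i d ≠ d := by
  revert d
  refine crossingEmbedding_cases hi (fun d => ?_) ?_ ?_ ?_ ?_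
  · rw [crossingEdge_crossingEmbedding]
    exact fun h => T.edge_ne d (crossingEmbedding_injective h)
  · exact Sum.inr_ne_inl
  · exact Sum.inr_ne_inl
  · rw [crossingEdge_inr_self]
    exact Sum.inl_ne_inr
  · rw [crossingEdge_inr_finRotate hi]
    exact Sum.inl_ne_inr

/-- Extends a function on the half-edges to the diagram with a further crossing. -/
def crossingExtend {α : Type} (i : Fin (2 * n)) (u : HalfEdge n T.Crossing → α) (a b a' b' : α) :
    HalfEdge n (Option T.Crossing) → α
  | Sum.inl (some c, k) => u (Sum.inl (c, k))
  | Sum.inl (none, k) => ![a, b, u (Sum.inr (finRotate _ i)), u (Sum.inr i)] k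
  | Sum.inr m => if m = i then a' else if m = finRotate _ i then b' else u (Sum.inr m)

theorem crossingExtend_crossingEmbedding {α : Type} (u : HalfEdge n T.Crossing → α)
    (a b a' b' : α) (d : HalfEdge n T.Crossing) :
    crossingExtend i u a b a' b' (T.crossingEmbedding i d) = u d := by
  rcases d with ⟨c, k⟩ | m
  · rfl
  · rw [crossingEmbedding]
    split_ifs with h h'
    · rw [h]; rfl
    · rw [h']; rfl
    · simp only [crossingExtend, if_neg h, if_neg h']

/-- A circulation on the new diagram restricts to one on the old diagram; its potential there
extends to the one new face. -/
theorem isPlanarMap_crossingEdge (hi : finRotate _ i ≠ i) :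
    IsPlanarMap (diskRotation n (Option T.Crossing))
      (crossingEdge_involutive (T := T) hi).toPerm := by
  have := T.finite_crossing
  have := Fintype.ofFinite T.Crossing
  refine isPlanarMap_of_exists_potential (ZMod 2) (crossingEdge_involutive hi)
    (crossingEdge_ne hi) fun z hz hr => ?_
  simp only [Function.Involutive.coe_toPerm] at hz ⊢
  obtain ⟨hX, hb⟩ := vertex_sums_of_sum_mul_eq_zero hr
  have hz₀ : z (Sum.inr i) = - z (Sum.inl (none, 0)) := hz (Sum.inl (none, 0))
  have hz₁ : z (Sum.inr (finRotate _ i)) = - z (Sum.inl (none, 1)) := hz (Sum.inl (none, 1))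
  have hc := hX none
  rw [Fin.sum_univ_four] at hc
  have hj : T.crossingEmbedding i (Sum.inr i) = Sum.inl (none, 3) := by simp [crossingEmbedding]
  have hj' : T.crossingEmbedding i (Sum.inr (finRotate _ i)) = Sum.inl (none, 2) := by
    simp only [crossingEmbedding, if_neg hi, if_true]
  have hj'' : ∀ m, m ≠ i → m ≠ finRotate _ i →
      T.crossingEmbedding i (Sum.inr m) = Sum.inr m := fun m h h' => by
    simp only [crossingEmbedding, if_neg h, if_neg h']
  -- The restriction replaces two boundary values by those at `(none, 3)` and `(none, 2)`; the
  -- vertex sum at the new crossing shows that the total is unchanged.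
  have hb' : ∑ m, z (T.crossingEmbedding i (Sum.inr m)) = 0 := by
    have h : ∀ m, z (T.crossingEmbedding i (Sum.inr m)) = z (Sum.inr m) +
        (if m = i then z (Sum.inl (none, 3)) - z (Sum.inr i) else 0) +
        (if m = finRotate _ i then z (Sum.inl (none, 2)) - z (Sum.inr (finRotate _ i)) else 0) := by
      intro m
      by_cases h : m = i
      · subst h
        rw [hj, if_pos rfl, if_neg (Ne.symm hi)]
        ring
      by_cases h' : m = finRotate _ i
      · subst h'
        rw [hj', if_neg h, if_pos rfl]
        ring
      · rw [hj'' m h h', if_neg h, if_neg h', add_zero, add_zero]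
    rw [Finset.sum_congr rfl fun m _ => h m, Finset.sum_add_distrib, Finset.sum_add_distrib, hb,
      Finset.sum_ite_eq', Finset.sum_ite_eq', if_pos (Finset.mem_univ _),
      if_pos (Finset.mem_univ _)]
    linear_combination hc - hz₀ - hz₁
  obtain ⟨u, hu, hu'⟩ := T.planar.exists_potential T.edge_edge T.edge_ne
    (z := fun d => z (T.crossingEmbedding i d))
    (fun d => by rw [← hz, crossingEdge_crossingEmbedding])
    (fun f hf => sum_mul_eq_zero_of_vertex_sums hf (fun c => hX (some c)) hb')
  have hui := hu' (Sum.inr i)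
  have hui' := hu' (Sum.inr (finRotate _ i))
  rw [hj, diskRotation_inr] at hui
  rw [hj', diskRotation_inr, Equiv.symm_apply_apply] at hui'
  -- `v` is the value on the new face between the crossing and the boundary circle, forced by the
  -- jump across the edge that ends at `finRotate _ i`.
  set v := u (Sum.inr (finRotate _ i)) - z (Sum.inr (finRotate _ i)) with hv
  set w := crossingExtend i u (u (Sum.inr i) - z (Sum.inl (none, 3))) v v
    (u (Sum.inr (finRotate _ i))) with hw
  have hwj : ∀ d, w (T.crossingEmbedding i d) = u d := crossingExtend_crossingEmbedding _ _ _ _ _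
  have hw₀ : w (Sum.inl (none, 0)) = u (Sum.inr i) - z (Sum.inl (none, 3)) := rfl
  have hw₁ : w (Sum.inl (none, 1)) = v := rfl
  have hw₂ : w (Sum.inl (none, 2)) = u (Sum.inr (finRotate _ i)) := rfl
  have hw₃ : w (Sum.inl (none, 3)) = u (Sum.inr i) := rfl
  have hwi : w (Sum.inr i) = v := by simp [hw, crossingExtend]
  have hwm : ∀ m, m ≠ i → w (Sum.inr m) = u (Sum.inr m) := by
    intro m hm
    simp only [hw, crossingExtend, if_neg hm]
    split_ifs with h
    · rw [h]
    · rfl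
  refine ⟨w, ?_, ?_⟩
  · refine crossingEmbedding_cases hi (fun d => ?_) ?_ ?_ ?_ ?_
    · rw [crossingEdge_crossingEmbedding, hwj, hwj, ← hu, ← hu']
    · rw [crossingEdge, hw₀, hwi]
      linear_combination hc - hui' - hz₁ + hv
    · rw [crossingEdge, hw₁, hwm _ hi]
      linear_combination hz₁ + hv
    · rw [crossingEdge_inr_self, hw₀, hwi]
      linear_combination hz₀ - (hc - hui' - hz₁ + hv)
    · rw [crossingEdge_inr_finRotate hi, hw₁, hwm _ hi]
      linear_combination -hv
  · rintro (⟨_ | c, k⟩ | m)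
    · rw [diskRotation_inl]
      fin_cases k
      · change z (Sum.inl (none, 0)) = w (Sum.inl (none, 0)) - w (Sum.inl (none, 1))
        rw [hw₀, hw₁]
        linear_combination hc - hui' - hz₁ + hv
      · change z (Sum.inl (none, 1)) = w (Sum.inl (none, 1)) - w (Sum.inl (none, 2))
        rw [hw₁, hw₂]
        linear_combination hz₁ + hv
      · change z (Sum.inl (none, 2)) = w (Sum.inl (none, 2)) - w (Sum.inl (none, 3))
        rw [hw₂, hw₃, hui']
      · change z (Sum.inl (none, 3)) = w (Sum.inl (none, 3)) - w (Sum.inl (none, 0))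
        rw [hw₃, hw₀]
        ring
    · exact (hu' (Sum.inl (c, k))).trans (by rw [diskRotation_inl, diskRotation_inl]; rfl)
    · rw [diskRotation_inr]
      by_cases h : m = i
      · subst h
        have hne : (finRotate _).symm m ≠ m := fun h => hi ((Equiv.symm_apply_eq _).mp h).symm
        rw [hwi, hwm _ hne]
        linear_combination hz₀ - (hc - hui' - hz₁ + hv) + hui
      by_cases h' : m = finRotate _ i
      · subst h'
        rw [Equiv.symm_apply_apply, hwi, hwm _ hi]
        linear_combination -hv
      · have hne : (finRotate _).symm m ≠ i := fun h => h' ((Equiv.symm_apply_eq _).mp h)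
        rw [hwm _ h, hwm _ hne, ← hj'' m h h']
        exact hu' (Sum.inr m)

/-- The diagram with a further crossing of the strands that end at `i` and at the following
boundary point; the strand that ends at `i` passes over the other. -/
def addCrossing (T : TangleDiagram n) {i : Fin (2 * n)} (hi : finRotate _ i ≠ i) :
    TangleDiagram n where
  Crossing := Option T.Crossing
  finite_crossing := have := T.finite_crossing; inferInstance
  edge := (crossingEdge_involutive hi).toPerm
  edge_edge := crossingEdge_involutive hi
  edge_ne := crossingEdge_ne hi
  planar := isPlanarMap_crossingEdge hi
  loops := T.loops

theorem crossingExtend_mem_halfEdgeColorings {k : ℕ} (hi : finRotate _ i ≠ i)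
    {x : HalfEdge n T.Crossing → ZMod k} (hx : x ∈ T.halfEdgeColorings k) :
    crossingExtend i x (2 * x (Sum.inr i) - x (Sum.inr (finRotate _ i))) (x (Sum.inr i))
      (2 * x (Sum.inr i) - x (Sum.inr (finRotate _ i))) (x (Sum.inr i)) ∈
        (T.addCrossing hi).halfEdgeColorings k := by
  set w := crossingExtend i x (2 * x (Sum.inr i) - x (Sum.inr (finRotate _ i))) (x (Sum.inr i))
      (2 * x (Sum.inr i) - x (Sum.inr (finRotate _ i))) (x (Sum.inr i)) with hw
  have hwi : w (Sum.inr i) = 2 * x (Sum.inr i) - x (Sum.inr (finRotate _ i)) := by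
    simp only [hw, crossingExtend, if_true]
  have hwi' : w (Sum.inr (finRotate _ i)) = x (Sum.inr i) := by
    simp only [hw, crossingExtend, if_true, if_neg hi]
  constructor
  · change ∀ d, w (T.crossingEdge i d) = w d
    refine crossingEmbedding_cases hi (fun d => ?_) hwi hwi' ?_ ?_
    · rw [crossingEdge_crossingEmbedding, hw, crossingExtend_crossingEmbedding,
        crossingExtend_crossingEmbedding, hx.1]
    · rw [crossingEdge_inr_self, hwi]; rfl
    · rw [crossingEdge_inr_finRotate hi, hwi']; rfl
  · rintro (_ | c)
    · exact ⟨rfl, sub_add_cancel _ _⟩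
    · exact hx.2 c

end AddCrossing

/-! ### Adding a strand between two new boundary points -/

section AddCup

variable {n : ℕ} (T : TangleDiagram n)

/-- The half-edges of a diagram as half-edges of the diagram with two further boundary points. -/
def cupEmbedding : HalfEdge n T.Crossing → HalfEdge (n + 1) T.Crossing :=
  Sum.map id fun m => (m.castSucc.castSucc : Fin (2 * n + 2))

/-- Extends a function on the half-edges to the diagram with two further boundary points. -/
def cupExtend {α : Type} (u : HalfEdge n T.Crossing → α) (a b : α) :
    HalfEdge (n + 1) T.Crossing → α :=
  Sum.elim (fun q => u (Sum.inl q))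
    (Fin.snoc (n := 2 * n + 1) (α := fun _ => α)
      (Fin.snoc (n := 2 * n) (α := fun _ => α) (fun m => u (Sum.inr m)) a) b)

/-- The first of the two further boundary points. -/
def cupFst (n : ℕ) : Fin (2 * (n + 1)) := (Fin.last (2 * n)).castSucc

/-- The second of the two further boundary points. -/
def cupSnd (n : ℕ) : Fin (2 * (n + 1)) := Fin.last (2 * n + 1)

/-- The edges of the diagram with a further strand between two further boundary points. -/
def cupEdge : HalfEdge (n + 1) T.Crossing → HalfEdge (n + 1) T.Crossing :=
  T.cupExtend (fun d => T.cupEmbedding (T.edge d)) (Sum.inr (cupSnd n)) (Sum.inr (cupFst n))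

variable {T}

theorem cupEmbedding_cases {P : HalfEdge (n + 1) T.Crossing → Prop}
    (h : ∀ d, P (T.cupEmbedding d)) (h₀ : P (Sum.inr (cupFst n)))
    (h₁ : P (Sum.inr (cupSnd n))) : ∀ d, P d := by
  rintro (q | m)
  · exact h (Sum.inl q)
  · refine Fin.lastCases (n := 2 * n + 1) h₁ (fun m => ?_) m
    exact Fin.lastCases (n := 2 * n) h₀ (fun m => h (Sum.inr m)) m

theorem cupExtend_cupEmbedding {α : Type} (u : HalfEdge n T.Crossing → α) (a b : α)
    (d : HalfEdge n T.Crossing) : T.cupExtend u a b (T.cupEmbedding d) = u d := by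
  rcases d with q | m
  · rfl
  · change Fin.snoc (n := 2 * n + 1) (α := fun _ => α) _ b m.castSucc.castSucc = _
    rw [Fin.snoc_castSucc, Fin.snoc_castSucc]

theorem cupExtend_cupFst {α : Type} (u : HalfEdge n T.Crossing → α) (a b : α) :
    T.cupExtend u a b (Sum.inr (cupFst n)) = a := by
  change Fin.snoc (n := 2 * n + 1) (α := fun _ => α) _ b (Fin.last (2 * n)).castSucc = _
  rw [Fin.snoc_castSucc, Fin.snoc_last]

theorem cupExtend_cupSnd {α : Type} (u : HalfEdge n T.Crossing → α) (a b : α) :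
    T.cupExtend u a b (Sum.inr (cupSnd n)) = b := by
  change Fin.snoc (n := 2 * n + 1) (α := fun _ => α) _ b (Fin.last (2 * n + 1)) = _
  rw [Fin.snoc_last]

theorem cupEdge_cupEmbedding (d : HalfEdge n T.Crossing) :
    T.cupEdge (T.cupEmbedding d) = T.cupEmbedding (T.edge d) := cupExtend_cupEmbedding _ _ _ d

theorem cupEdge_cupFst : T.cupEdge (Sum.inr (cupFst n)) = Sum.inr (cupSnd n) :=
  cupExtend_cupFst _ _ _

theorem cupEdge_cupSnd : T.cupEdge (Sum.inr (cupSnd n)) = Sum.inr (cupFst n) :=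
  cupExtend_cupSnd _ _ _

theorem cupEmbedding_injective : Function.Injective T.cupEmbedding :=
  Sum.map_injective.mpr ⟨Function.injective_id, fun _ _ h =>
    Fin.castSucc_injective _ (Fin.castSucc_injective _ h)⟩

theorem cupEdge_involutive : Function.Involutive T.cupEdge := by
  refine cupEmbedding_cases (fun d => ?_) ?_ ?_
  · rw [cupEdge_cupEmbedding, cupEdge_cupEmbedding, T.edge_edge]
  · rw [cupEdge_cupFst, cupEdge_cupSnd]
  · rw [cupEdge_cupSnd, cupEdge_cupFst]

theorem cupFst_ne_cupSnd : cupFst n ≠ cupSnd n := (Fin.castSucc_lt_last _).ne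

theorem cupEdge_ne (d : HalfEdge (n + 1) T.Crossing) : T.cupEdge d ≠ d := by
  revert d
  refine cupEmbedding_cases (fun d => ?_) ?_ ?_
  · rw [cupEdge_cupEmbedding]
    exact fun h => T.edge_ne d (cupEmbedding_injective h)
  · rw [cupEdge_cupFst]
    exact fun h => cupFst_ne_cupSnd (Sum.inr_injective h).symm
  · rw [cupEdge_cupSnd]
    exact fun h => cupFst_ne_cupSnd (Sum.inr_injective h)

theorem finRotate_cupFst : finRotate _ (cupFst n) = cupSnd n := by
  rw [cupFst, show finRotate (2 * (n + 1)) = finRotate (2 * n + 1 + 1) from rfl,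
    finRotate_apply]
  ext
  simp [cupSnd]

theorem sum_cup {R : Type*} [AddCommMonoid R] (f : Fin (2 * (n + 1)) → R) :
    ∑ m, f m = ∑ m : Fin (2 * n), f (m.castSucc.castSucc : Fin (2 * n + 2)) + f (cupFst n) +
      f (cupSnd n) := by
  change ∑ m : Fin (2 * n + 1 + 1), f m = _
  rw [Fin.sum_univ_castSucc, Fin.sum_univ_castSucc]
  rfl

theorem val_finRotate_of_lt {m : ℕ} {i : Fin m} (h : (i : ℕ) + 1 < m) :
    (finRotate m i : ℕ) = i + 1 := by
  obtain ⟨m, rfl⟩ := Nat.exists_eq_succ_of_ne_zero i.pos.ne'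
  exact coe_finRotate_of_ne_last fun hi => by simp [hi] at h

theorem val_finRotate_of_eq {m : ℕ} {i : Fin m} (h : (i : ℕ) + 1 = m) :
    (finRotate m i : ℕ) = 0 := by
  obtain ⟨m, rfl⟩ := Nat.exists_eq_succ_of_ne_zero i.pos.ne'
  rw [show i = Fin.last m from Fin.ext (by simpa using h), finRotate_last]
  rfl

theorem finRotate_symm_castSucc_castSucc (m : Fin (2 * n)) (hm : (m : ℕ) ≠ 0) :
    (finRotate (2 * (n + 1))).symm (m.castSucc.castSucc : Fin (2 * n + 2)) =
      (((finRotate (2 * n)).symm m).castSucc.castSucc : Fin (2 * n + 2)) := by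
  obtain ⟨m, rfl⟩ := (finRotate (2 * n)).surjective m
  rw [Equiv.symm_apply_apply, Equiv.symm_apply_eq]
  have h : (m : ℕ) + 1 < 2 * n :=
    lt_of_le_of_ne m.isLt fun h => hm (val_finRotate_of_eq h)
  ext
  rw [val_finRotate_of_lt (by simp only [Fin.val_castSucc]; omega)]
  simp only [Fin.val_castSucc, val_finRotate_of_lt h]

/-- The old potential extends to the face cut off by the new strand; the jump across the strand
determines its value there. -/
theorem isPlanarMap_cupEdge :
    IsPlanarMap (diskRotation (n + 1) T.Crossing) (cupEdge_involutive (T := T)).toPerm := by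
  have := T.finite_crossing
  have := Fintype.ofFinite T.Crossing
  refine isPlanarMap_of_exists_potential (ZMod 2) cupEdge_involutive cupEdge_ne fun z hz hr => ?_
  simp only [Function.Involutive.coe_toPerm] at hz ⊢
  obtain ⟨hX, hb⟩ := vertex_sums_of_sum_mul_eq_zero hr
  have hz₀ : z (Sum.inr (cupSnd n)) = - z (Sum.inr (cupFst n)) := by rw [← hz, cupEdge_cupFst]
  rw [sum_cup, hz₀, add_neg_cancel_right] at hb
  obtain ⟨u, hu, hu'⟩ := T.planar.exists_potential T.edge_edge T.edge_ne
    (z := fun d => z (T.cupEmbedding d)) (fun d => by rw [← hz, cupEdge_cupEmbedding])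
    (fun f hf => sum_mul_eq_zero_of_vertex_sums hf hX hb)
  -- `v` is the value on the old face between the last and the first boundary point, where the
  -- strand is inserted. For `n = 0` there is no such face, and 0 is an arbitrary choice.
  obtain ⟨v, hv⟩ : ∃ v, ∀ m : Fin (2 * n), (m : ℕ) = 0 →
      u (Sum.inr ((finRotate _).symm m)) = v := by
    by_cases h : 0 < 2 * n
    · exact ⟨_, fun m hm => by rw [show m = ⟨0, h⟩ from Fin.ext hm]⟩
    · exact ⟨0, fun m => absurd m.isLt (by omega)⟩
  set w := T.cupExtend u (v + z (Sum.inr (cupFst n))) v with hw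
  have hwj : ∀ d, w (T.cupEmbedding d) = u d := cupExtend_cupEmbedding _ _ _
  have hwm : ∀ m : Fin (2 * n), w (Sum.inr (m.castSucc.castSucc : Fin (2 * n + 2))) =
    u (Sum.inr m) := fun m => hwj (Sum.inr m)
  have hw₀ : w (Sum.inr (cupFst n)) = v + z (Sum.inr (cupFst n)) := cupExtend_cupFst _ _ _
  have hw₁ : w (Sum.inr (cupSnd n)) = v := cupExtend_cupSnd _ _ _
  refine ⟨w, cupEmbedding_cases (fun d => ?_) ?_ ?_, cupEmbedding_cases ?_ ?_ ?_⟩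
  · rw [cupEdge_cupEmbedding, hwj, hwj, ← hu, ← hu']
  · rw [cupEdge_cupFst, hw₀, hw₁, add_sub_cancel_left]
  · rw [cupEdge_cupSnd, hw₀, hw₁, hz₀]
    ring
  · rintro (⟨c, k⟩ | m)
    · refine (hu' (Sum.inl (c, k))).trans ?_
      change _ = w (Sum.inl (c, k)) - w (diskRotation (n + 1) _ (Sum.inl (c, k)))
      rw [diskRotation_inl, diskRotation_inl]
      rfl
    · refine (hu' (Sum.inr m)).trans ?_
      rw [hwj, diskRotation_inr]
      congr 1
      change _ = w (Sum.inr ((finRotate (2 * (n + 1))).symm (m.castSucc.castSucc : Fin (2 * n + 2))))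
      by_cases hm : (m : ℕ) = 0
      · rw [hv m hm, show (finRotate (2 * (n + 1))).symm (m.castSucc.castSucc : Fin (2 * n + 2)) =
          cupSnd n from ?_, hw₁]
        rw [Equiv.symm_apply_eq]
        ext
        rw [val_finRotate_of_eq rfl]
        exact hm
      · rw [finRotate_symm_castSucc_castSucc m hm, hwm]
  · have h : w (Sum.inr ((finRotate _).symm (cupFst n))) = v := by
      by_cases hn : 0 < 2 * n
      · obtain ⟨l, hl⟩ := (finRotate (2 * n)).surjective ⟨0, hn⟩
        have hl' : (l : ℕ) + 1 = 2 * n := by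
          by_contra h
          have := val_finRotate_of_lt (lt_of_le_of_ne l.isLt h)
          rw [hl] at this
          simp at this
        rw [show (finRotate _).symm (cupFst n) = (l.castSucc.castSucc : Fin (2 * n + 2)) from ?_,
          hwm, ← hv ⟨0, hn⟩ rfl, ← hl, Equiv.symm_apply_apply]
        rw [Equiv.symm_apply_eq]
        ext
        rw [val_finRotate_of_lt (by simp only [Fin.val_castSucc]; omega)]
        exact hl'.symm
      · rw [show (finRotate _).symm (cupFst n) = cupSnd n from ?_, hw₁]
        rw [Equiv.symm_apply_eq]
        ext
        rw [val_finRotate_of_eq rfl]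
        change 2 * n = 0
        omega
    rw [diskRotation_inr, hw₀, h, add_sub_cancel_left]
  · rw [diskRotation_inr, ← finRotate_cupFst, Equiv.symm_apply_apply, finRotate_cupFst, hw₀, hw₁,
      hz₀]
    ring

variable (T) in
/-- The diagram with a further strand between two further boundary points. -/
def addCup : TangleDiagram (n + 1) where
  Crossing := T.Crossing
  finite_crossing := T.finite_crossing
  edge := cupEdge_involutive.toPerm
  edge_edge := cupEdge_involutive
  edge_ne := cupEdge_ne
  planar := isPlanarMap_cupEdge
  loops := T.loops

theorem cupExtend_mem_halfEdgeColorings {k : ℕ} {x : HalfEdge n T.Crossing → ZMod k}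
    (hx : x ∈ T.halfEdgeColorings k) (a : ZMod k) :
    T.cupExtend x a a ∈ T.addCup.halfEdgeColorings k := by
  refine ⟨?_, hx.2⟩
  change ∀ d, T.cupExtend x a a (T.cupEdge d) = T.cupExtend x a a d
  refine cupEmbedding_cases (fun d => ?_) ?_ ?_
  · rw [cupEdge_cupEmbedding, cupExtend_cupEmbedding, cupExtend_cupEmbedding, hx.1]
  · rw [cupEdge_cupFst, cupExtend_cupFst, cupExtend_cupSnd]
  · rw [cupEdge_cupSnd, cupExtend_cupFst, cupExtend_cupSnd]

end AddCup

end TangleDiagram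

/-! ### Realizing every alternating coloring -/

/-- A coloring of the boundary points is realizable if some Fox coloring of some diagram
induces it. -/
def IsRealizable {k n : ℕ} (a : Fin (2 * n) → ZMod k) : Prop :=
  ∃ T : TangleDiagram n, a ∈ LinearMap.range (T.psi k)

theorem isRealizable_iff {k n : ℕ} {a : Fin (2 * n) → ZMod k} : IsRealizable a ↔
    ∃ T : TangleDiagram n, ∃ x ∈ T.halfEdgeColorings k, ∀ i, x (Sum.inr i) = a i := by
  refine exists_congr fun T => ?_
  rw [T.range_psi]
  exact exists_congr fun x => and_congr_right fun _ => funext_iff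

instance : IsEmpty (HalfEdge 0 Empty) :=
  ⟨by
    rintro (⟨c, -⟩ | i)
    · exact c.elim
    · exact i.elim0⟩

/-- The diagram without crossings and boundary points. -/
def emptyDiagram : TangleDiagram 0 where
  Crossing := Empty
  finite_crossing := inferInstance
  edge := 1
  edge_edge _ := rfl
  edge_ne d := isEmptyElim d
  planar := isPlanarMap_of_exists_potential ℚ (fun _ => rfl) (fun d => isEmptyElim d)
    fun _ _ _ => ⟨0, fun d => isEmptyElim d, fun d => isEmptyElim d⟩
  loops := 0

theorem isRealizable_of_cup {k n : ℕ} {a : Fin (2 * (n + 1)) → ZMod k}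
    (h : IsRealizable fun m : Fin (2 * n) => a (m.castSucc.castSucc : Fin (2 * n + 2)))
    (ha : a (TangleDiagram.cupFst n) = a (TangleDiagram.cupSnd n)) : IsRealizable a := by
  rw [isRealizable_iff] at h ⊢
  obtain ⟨T, x, hx, hxa⟩ := h
  refine ⟨T.addCup, _, TangleDiagram.cupExtend_mem_halfEdgeColorings hx
    (a (TangleDiagram.cupFst n)), fun m => ?_⟩
  refine Fin.lastCases (n := 2 * n + 1) ?_ (fun m => ?_) m
  · exact (TangleDiagram.cupExtend_cupSnd _ _ _).trans ha
  · refine Fin.lastCases (n := 2 * n) ?_ (fun m => ?_) m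
    · exact TangleDiagram.cupExtend_cupFst _ _ _
    · exact (TangleDiagram.cupExtend_cupEmbedding x _ _ (Sum.inr m)).trans (hxa m)

/-- The indicator function of a boundary point and the following one. -/
def pairIndicator (k : ℕ) {m : ℕ} (i : Fin m) : Fin m → ZMod k :=
  Pi.single i 1 + Pi.single (finRotate m i) 1

section PairIndicator

variable {k m : ℕ} {i : Fin m}

theorem pairIndicator_self (hi : finRotate m i ≠ i) : pairIndicator k i i = 1 := by
  simp only [pairIndicator, Pi.add_apply, Pi.single_eq_same, Pi.single_eq_of_ne hi.symm, add_zero]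

theorem pairIndicator_finRotate (hi : finRotate m i ≠ i) :
    pairIndicator k i (finRotate m i) = 1 := by
  simp only [pairIndicator, Pi.add_apply, Pi.single_eq_same, Pi.single_eq_of_ne hi, zero_add]

theorem pairIndicator_of_ne {j : Fin m} (h : j ≠ i) (h' : j ≠ finRotate m i) :
    pairIndicator k i j = 0 := by
  simp only [pairIndicator, Pi.add_apply, Pi.single_eq_of_ne h, Pi.single_eq_of_ne h', zero_add]

theorem pairIndicator_mem_alternatingColorings {n : ℕ} (i : Fin (2 * n)) :
    pairIndicator k i ∈ alternatingColorings k n := by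
  change ∑ j : Fin (2 * n), (-1) ^ ((j : ℕ) + 1) *
    (Pi.single i 1 + Pi.single (finRotate _ i) 1 : Fin (2 * n) → ZMod k) j = 0
  simp only [Pi.add_apply, mul_add, Finset.sum_add_distrib, Pi.single_apply, mul_ite, mul_one,
    mul_zero, Finset.sum_ite_eq', Finset.mem_univ, if_true, pow_succ _ (finRotate _ i : ℕ),
    neg_one_pow_finRotate (even_two_mul n)]
  ring

end PairIndicator

section Realization

variable {n : ℕ} {i : Fin (2 * n)}

theorem IsRealizable.addCrossing {k : ℕ} {a : Fin (2 * n) → ZMod k} (h : IsRealizable a)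
    (hi : finRotate _ i ≠ i) :
    IsRealizable (a - (a (finRotate _ i) - a i) • pairIndicator k i) := by
  rw [isRealizable_iff] at h ⊢
  obtain ⟨T, x, hx, hxa⟩ := h
  refine ⟨T.addCrossing hi, _, TangleDiagram.crossingExtend_mem_halfEdgeColorings hi hx,
    fun m => ?_⟩
  simp only [TangleDiagram.crossingExtend, Pi.sub_apply, Pi.smul_apply, smul_eq_mul, hxa]
  split_ifs with h h'
  · rw [h, pairIndicator_self hi]
    ring
  · rw [h', pairIndicator_finRotate hi]
    ring
  · rw [pairIndicator_of_ne h h']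
    ring

/-- A crossing preserves `a (finRotate _ i) - a i`, so each repetition subtracts the same multiple
of `pairIndicator k i`. -/
theorem IsRealizable.addCrossings {k : ℕ} {a : Fin (2 * n) → ZMod k} (h : IsRealizable a)
    (hi : finRotate _ i ≠ i) (r : ℕ) :
    IsRealizable (a - ((r : ZMod k) * (a (finRotate _ i) - a i)) • pairIndicator k i) := by
  induction r with
  | zero => simpa using h
  | succ r ih =>
    convert ih.addCrossing hi using 1
    ext m
    simp only [Pi.sub_apply, Pi.smul_apply, smul_eq_mul, pairIndicator_self hi,
      pairIndicator_finRotate hi]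
    push_cast
    ring

variable {p : ℕ} [Fact p.Prime]

/-- The nonzero difference is invertible modulo `p`, so `c` divided by it, lifted to `ℕ`, is a
number of crossings that undoes the added term. -/
theorem IsRealizable.of_add_smul_pairIndicator {a : Fin (2 * n) → ZMod p}
    (hi : finRotate _ i ≠ i) (ha : a (finRotate _ i) ≠ a i) {c : ZMod p}
    (h : IsRealizable (a + c • pairIndicator p i)) : IsRealizable a := by
  have hd : a (finRotate _ i) - a i ≠ 0 := sub_ne_zero.mpr ha
  convert h.addCrossings hi (c / (a (finRotate _ i) - a i)).val using 1
  ext m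
  simp only [Pi.sub_apply, Pi.add_apply, Pi.smul_apply, smul_eq_mul, pairIndicator_self hi,
    pairIndicator_finRotate hi, ZMod.natCast_zmod_val, add_sub_add_right_eq_sub]
  rw [div_mul_cancel₀ _ hd]
  ring

theorem isRealizable_of_mem_alternatingColorings (n : ℕ) {a : Fin (2 * n) → ZMod p}
    (ha : a ∈ alternatingColorings p n) : IsRealizable a := by
  induction n with
  | zero => exact ⟨emptyDiagram, 0, funext fun i => i.elim0⟩
  | succ n ih =>
    have hsum : ∀ b ∈ alternatingColorings p (n + 1),
        ∑ m : Fin (2 * n), (-1) ^ ((m : ℕ) + 1) * b (m.castSucc.castSucc : Fin (2 * n + 2)) =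
          b (TangleDiagram.cupFst n) - b (TangleDiagram.cupSnd n) := by
      intro b hb
      have h := (TangleDiagram.sum_cup _).symm.trans hb
      have h₀ : ((TangleDiagram.cupFst n : Fin _) : ℕ) = 2 * n := rfl
      have h₁ : ((TangleDiagram.cupSnd n : Fin _) : ℕ) = 2 * n + 1 := rfl
      simp only [Fin.val_castSucc, h₀, h₁, pow_succ, pow_mul] at h ⊢
      linear_combination h
    have hcup : ∀ b ∈ alternatingColorings p (n + 1),
        b (TangleDiagram.cupFst n) = b (TangleDiagram.cupSnd n) → IsRealizable b :=
      fun b hb h => isRealizable_of_cup (ih ((hsum b hb).trans (sub_eq_zero.mpr h))) h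
    rcases Nat.eq_zero_or_pos n with rfl | hn
    · exact hcup a ha (sub_eq_zero.mp ((hsum a ha).symm.trans Finset.sum_empty))
    set r := TangleDiagram.cupSnd n with hr
    set q := TangleDiagram.cupFst n with hq
    have hrv : (r : ℕ) = 2 * n + 1 := rfl
    have hqv : (q : ℕ) = 2 * n := rfl
    have hqr : finRotate _ q = r := TangleDiagram.finRotate_cupFst
    obtain ⟨s, hsq⟩ := (finRotate (2 * (n + 1))).surjective q
    have hsv : (s : ℕ) + 1 = 2 * n := by
      by_cases h : (s : ℕ) + 1 < 2 * (n + 1)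
      · rw [← TangleDiagram.val_finRotate_of_lt h, hsq, hqv]
      · have := TangleDiagram.val_finRotate_of_eq (i := s) (by omega)
        rw [hsq] at this
        omega
    have hsq' : s ≠ q := fun h => by rw [h] at hsv; omega
    have hsr : s ≠ r := fun h => by rw [h] at hsv; omega
    have hqr' : q ≠ r := TangleDiagram.cupFst_ne_cupSnd
    have his : finRotate _ s ≠ s := by rw [hsq]; exact hsq'.symm
    have hiq : finRotate _ q ≠ q := by rw [hqr]; exact hqr'.symm
    have hmem : ∀ b ∈ alternatingColorings p (n + 1), ∀ j (c : ZMod p),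
        b + c • pairIndicator p j ∈ alternatingColorings p (n + 1) := fun b hb j c =>
      Submodule.add_mem _ hb (Submodule.smul_mem _ _ (pairIndicator_mem_alternatingColorings j))
    have hmid : ∀ b ∈ alternatingColorings p (n + 1), b q ≠ b s → IsRealizable b := by
      intro b hb h
      -- Adding `b r - b q` at `s` and `q` makes the color at `q` equal to that at `r`, which is
      -- left alone; this is where `r ≠ s` matters.
      refine IsRealizable.of_add_smul_pairIndicator his (by rwa [hsq]) (c := b r - b q)
        (hcup _ (hmem b hb _ _) ?_)
      have h₁ : pairIndicator p s q = 1 := by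
        conv_lhs => rw [← hsq]
        exact pairIndicator_finRotate his
      have h₂ : pairIndicator p s r = 0 := pairIndicator_of_ne hsr.symm (by rw [hsq]; exact hqr'.symm)
      simp only [Pi.add_apply, Pi.smul_apply, smul_eq_mul, h₁, h₂]
      ring
    by_cases h : a q = a r
    · exact hcup a ha h
    by_cases h' : a q = a s
    -- Here the colors at `s` and `q` agree but those at `q` and `r` differ. A twist at `q`, `r`
    -- shifts the color at `q` by 1 and fixes that at `s`, which reduces to `hmid`.
    · refine IsRealizable.of_add_smul_pairIndicator hiq (by rw [hqr]; exact Ne.symm h) (c := 1)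
        (hmid _ (hmem a ha _ _) ?_)
      have h₁ : pairIndicator p q s = 0 := pairIndicator_of_ne hsq' (by rwa [hqr])
      simp only [Pi.add_apply, Pi.smul_apply, smul_eq_mul, pairIndicator_self hiq, h₁, h']
      simp
    · exact hmid a ha h'

end Realization

theorem corollary2p6 (p : ℕ) [Fact p.Prime] (n : ℕ) (hn : 1 ≤ n) :
    ((alternatingColorings p n : Set (Fin (2 * n) → ZMod p)) =
        (⋃ T : TangleDiagram n, (LinearMap.range (T.psi p) : Set (Fin (2 * n) → ZMod p)))) ∧
      (∀ T : TangleDiagram n, Module.finrank (ZMod p) (LinearMap.range (T.psi p)) = n) := by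
  refine ⟨Set.Subset.antisymm (fun a ha => ?_) (Set.iUnion_subset fun T => ?_),
    TangleDiagram.finrank_range_psi p hn⟩
  · exact Set.mem_iUnion.mpr (isRealizable_of_mem_alternatingColorings n ha)
  · exact TangleDiagram.range_psi_le_alternatingColorings p
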